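/- **Setting.** Write a quaternion as $u+jv=\binom{u}{v}$ with $u,v\in\mathbf C$, so that $\binom{z_1}{z_2}\cdot\binom{w_1}{w_2}=\binom{z_1w_1-\bar z_2w_2}{\bar z_1w_2+z_2w_1}$, and put $\mathrm{tr}\binom uv=u+\bar u$. On $\mathbf C^2$ let $e_-=-\bar z_2\partial_{z_1}+\bar z_1\partial_{z_2}$, $\hat e_-=\bar z_2\partial_{\bar z_1}-z_1\partial_{z_2}$, $v^k_{(a,b)}=(e_-)^k z_1^a z_2^b$, $w^k_{(a,b)}=(\hat e_-)^k z_2^a\bar z_1^b$. For $m\ge 0$, $0\le l\le m$, $0\le k\le m+1$ let $$\phi^{+(m,l,k)}=\sqrt{\tfrac{(m+1-k)!}{k!\,l!\,(m-l)!}}\binom{k\,v^{k-1}_{(l,m-l)}}{-v^k_{(l,m-l)}},\qquad \phi^{-(m,l,k)}=\sqrt{\tfrac{(m+1-k)!}{k!\,l!\,(m-l)!}}\;|z|^{-2(m+2)}\binom{w^k_{(m+1-l,l)}}{w^k_{(m-l,l+1)}},$$ functions $\mathbf C^2\setminus\{0\}\to\mathbf H$; in particular $\phi^{+(0,0,1)}=\binom10$.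 Let $\mathbf C[\phi^\pm]$ be the real algebra of functions $\mathbf C^2\setminus\{0\}\to\mathbf H$ (pointwise product) generated by the complex multiples ($c\binom uv=\binom{cu}{cv}$, $c\in\mathbf C$) of all $\phi^{\pm(m,l,k)}$, and let $\mathbf C[\phi^\pm;m]=\{\varphi\in\mathbf C[\phi^\pm] : \varphi(z)=|z|^m\varphi(z/|z|)\}$ for $m\in\mathbf Z$. Applied to both components, let $d_0=\frac12(z_1\partial_{z_1}+z_2\partial_{z_2}+\bar z_1\partial_{\bar z_1}+\bar z_2\partial_{\bar z_2})$, $\Theta=\frac1{2\sqrt{-1}}(z_1\partial_{z_1}+z_2\partial_{z_2}-\bar z_1\partial_{\bar z_1}-\bar z_2\partial_{\bar z_2})$, and let $c(\phi_1,\phi_2)=\frac1{2\pi^2}\int_{S^3}\mathrm{tr}(\Theta\phi_1\cdot\phi_2)\,d\sigma$ with $\sigma$ the surface measure of $S^3=\{|z|=1\}$. Let $\mathfrak g$ be a finite-dimensional simple complex Lie algebra, $\mathfrak h$ a Cartan subalgebra, $\Sigma\subset\mathfrak h^*$ the root lattice, $U(\mathfrak g)$ the enveloping algebra, $(X|Y)=\mathrm{tr}_{\mathfrak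 g}(\mathrm{ad}X\,\mathrm{ad}Y)$ for $X,Y\in U(\mathfrak g)$ (with $\mathrm{ad}$ extended to $U(\mathfrak g)\to\mathrm{End}(\mathfrak g)$), and $\mathfrak g^U_\lambda=\{X\in U(\mathfrak g): hX-Xh=\lambda(h)X\ \forall h\in\mathfrak h\}$ for $\lambda\in\mathfrak h^*$. Let $\widehat{\mathfrak g}=(\mathbf C[\phi^\pm]\otimes U(\mathfrak g))\oplus\mathbf Ca\oplus\mathbf Cd$, the tensor product being over $\mathbf R$ with complex scalars acting on $U(\mathfrak g)$, with the skew-symmetric $\mathbf C$-bilinear bracket determined by $$[\phi\otimes X,\psi\otimes Y]=(\phi\psi)\otimes(XY)-(\psi\phi)\otimes(YX)+(X|Y)c(\phi,\psi)a,\quad [d,\phi\otimes X]=d_0\phi\otimes X,\quad [a,\,\cdot\,]=0 .$$ Let $\widehat{\mathfrak h}=(\phi^{+(0,0,1)}\otimes\mathfrak h)\oplus\mathbf Ca\oplus\mathbf Cd\cong\mathfrak h\oplus\mathbf Ca\oplus\mathbf Cd$ (the map $h\mapsto\phi^{+(0,0,1)}\otimes h$ is injective). Extend $\lambda\in\mathfrak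 h^*$ to $\widehat{\mathfrak h}$ by $\lambda(a)=\lambda(d)=0$ and define $\delta\in\widehat{\mathfrak h}^*$ by $\delta|_{\mathfrak h}=0$, $\delta(a)=0$, $\delta(d)=1$. For $\mu\in\widehat{\mathfrak h}^*$ put $\widehat{\mathfrak g}_\mu=\{\xi\in\widehat{\mathfrak g}:[\hat h,\xi]=\mu(\hat h)\xi\ \forall\hat h\in\widehat{\mathfrak h}\}$; $\mu$ is a weight of $\widehat{\mathfrak g}$ if $\widehat{\mathfrak g}_\mu\ne0$, and $\lambda\in\mathfrak h^*$ is a weight of $U(\mathfrak g)$ if $\mathfrak g^U_\lambda\neq0$. **Theorem.** The set of weights of $U(\mathfrak g)$ is the root lattice $\Sigma$, and: 1. The set of weights of $\widehat{\mathfrak g}$ is $\{\frac m2\delta+\lambda:\lambda\in\Sigma,\ m\in\mathbf Z\}\cup\{\frac m2\delta:m\in\mathbf Z\}$. 2. For $\lambda\in\Sigma$, $\lambda\ne0$, and $m\in\mathbf Z$: $\widehat{\mathfrak g}_{\frac m2\delta+\lambda}=\mathbf C[\phi^\pm;m]\otimes\mathfrak g^U_\lambda$. 3. $\widehat{\mathfrak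 g}_{0\delta}=(\mathbf C[\phi^\pm;0]\otimes\mathfrak g^U_0)\oplus\mathbf Ca\oplus\mathbf Cd\supset\widehat{\mathfrak h}$, and $\widehat{\mathfrak g}_{\frac m2\delta}=\mathbf C[\phi^\pm;m]\otimes\mathfrak g^U_0$ for $0\ne m\in\mathbf Z$. 4. $\widehat{\mathfrak g}=\bigoplus_{m\in\mathbf Z}\widehat{\mathfrak g}_{\frac m2\delta}\ \oplus\ \bigoplus_{0\ne\lambda\in\Sigma,\ m\in\mathbf Z}\widehat{\mathfrak g}_{\frac m2\delta+\lambda}$. -/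

import Mathlib

open scoped TensorProduct Quaternion ContDiff

namespace QuatCurrent

noncomputable section

/-! ### Spinors on the punctured plane -/

/-- The plane `ℂ²` with its Hermitian norm `|z|² = |z₁|² + |z₂|²`; `z₁ = z 0`, `z₂ = z 1`. -/
abbrev Plane : Type := EuclideanSpace ℂ (Fin 2)

/-- The punctured plane `ℂ² \ {0}`. -/
abbrev Punctured : Type := {z : Plane // z ≠ 0}

/-- Even spinors on `ℂ² \ {0}`: maps into the quaternions, with pointwise (quaternion)
multiplication. -/
abbrev Spinor : Type := Punctured → ℍ[ℝ]

/-- The quaternion `u + j v`, that is, the column `(u, v)` of two complex numbers. -/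
def column (u v : ℂ) : ℍ[ℝ] := ⟨u.re, u.im, v.re, -v.im⟩

@[simp] theorem column_re (u v : ℂ) : (column u v).re = u.re := rfl
@[simp] theorem column_imI (u v : ℂ) : (column u v).imI = u.im := rfl
@[simp] theorem column_imJ (u v : ℂ) : (column u v).imJ = v.re := rfl
@[simp] theorem column_imK (u v : ℂ) : (column u v).imK = -v.im := rfl

/-- First entry `u` of the column of `q = u + j v`. -/
def fstC (q : ℍ[ℝ]) : ℂ := ⟨q.re, q.imI⟩

/-- Second entry `v` of the column of `q = u + j v`. -/
def sndC (q : ℍ[ℝ]) : ℂ := ⟨q.imJ, -q.imK⟩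

/-- The identification of `ℍ` with columns turns quaternion multiplication into
`(z₁, z₂) · (w₁, w₂) = (z₁ w₁ - conj z₂ w₂, conj z₁ w₂ + z₂ w₁)`. -/
theorem column_mul (z₁ z₂ w₁ w₂ : ℂ) :
    column z₁ z₂ * column w₁ w₂ =
      column (z₁ * w₁ - (starRingEnd ℂ) z₂ * w₂) ((starRingEnd ℂ) z₁ * w₂ + z₂ * w₁) := by
  ext <;> simp <;> ring

theorem column_fst_snd (q : ℍ[ℝ]) : column (fstC q) (sndC q) = q := by
  ext <;> simp [fstC, sndC]

/-- Trace of a quaternion, `tr (u + j v) = u + conj u = 2 Re u`. -/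
def quatTr (q : ℍ[ℝ]) : ℝ := 2 * q.re

/-- Multiplication of a spinor by a complex scalar: `c (u, v) = (c u, c v)`. -/
def cscale (c : ℂ) (φ : Spinor) : Spinor := fun z => column (c * fstC (φ z)) (c * sndC (φ z))

/-! ### The polynomials `v` and `w`, and the basic spinors -/

/-- Polynomials in `z₁, z₂` (left variables) and `conj z₁, conj z₂` (right variables). -/
abbrev Poly : Type := MvPolynomial (Fin 2 ⊕ Fin 2) ℂ

/-- The variable `z_{j+1}`. -/
def pz (j : Fin 2) : Poly := MvPolynomial.X (Sum.inl j)

/-- The variable `conj z_{j+1}`. -/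
def pzbar (j : Fin 2) : Poly := MvPolynomial.X (Sum.inr j)

/-- `e₋ = - conj z₂ ∂/∂z₁ + conj z₁ ∂/∂z₂`. -/
def eMinus (p : Poly) : Poly :=
  -pzbar 1 * MvPolynomial.pderiv (Sum.inl 0) p + pzbar 0 * MvPolynomial.pderiv (Sum.inl 1) p

/-- `ê₋ = conj z₂ ∂/∂(conj z₁) - z₁ ∂/∂z₂`. -/
def eHatMinus (p : Poly) : Poly :=
  pzbar 1 * MvPolynomial.pderiv (Sum.inr 0) p - pz 0 * MvPolynomial.pderiv (Sum.inl 1) p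

/-- `v^k_{(a,b)} = (e₋)^k z₁^a z₂^b`. -/
def vPoly (k a b : ℕ) : Poly := eMinus^[k] (pz 0 ^ a * pz 1 ^ b)

/-- `w^k_{(a,b)} = (ê₋)^k z₂^a (conj z₁)^b`. -/
def wPoly (k a b : ℕ) : Poly := eHatMinus^[k] (pz 1 ^ a * pzbar 0 ^ b)

/-- Value of a polynomial in `z, conj z` at a point of the plane. -/
def polyEval (p : Poly) (z : Plane) : ℂ :=
  MvPolynomial.eval (Sum.elim (fun j => z j) (fun j => (starRingEnd ℂ) (z j))) p

/-- The factor `√((m+1-k)! / (k! l! (m-l)!))`. -/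
def normFactor (m l k : ℕ) : ℝ :=
  Real.sqrt (((m + 1 - k).factorial : ℝ) /
    ((k.factorial : ℝ) * (l.factorial : ℝ) * ((m - l).factorial : ℝ)))

/-- The spinor `φ^{+(m,l,k)}`. -/
def phiPlus (m l k : ℕ) : Spinor := fun z =>
  column ((normFactor m l k : ℂ) * ((k : ℂ) * polyEval (vPoly (k - 1) l (m - l)) z))
    ((normFactor m l k : ℂ) * (-polyEval (vPoly k l (m - l)) z))

/-- The spinor `φ^{-(m,l,k)}`. -/
def phiMinus (m l k : ℕ) : Spinor := fun z =>
  column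
    ((normFactor m l k : ℂ) * ((((1 / ‖(z : Plane)‖ ^ 2) ^ (m + 2) : ℝ) : ℂ) *
      polyEval (wPoly k (m + 1 - l) l) z))
    ((normFactor m l k : ℂ) * ((((1 / ‖(z : Plane)‖ ^ 2) ^ (m + 2) : ℝ) : ℂ) *
      polyEval (wPoly k (m - l) (l + 1)) z))

/-- The complex multiples of the spinors `φ^{±(m,l,k)}`, `0 ≤ l ≤ m`, `0 ≤ k ≤ m + 1`. -/
def generators : Set Spinor :=
  {ψ | ∃ (c : ℂ) (m l k : ℕ), l ≤ m ∧ k ≤ m + 1 ∧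
    (ψ = cscale c (phiPlus m l k) ∨ ψ = cscale c (phiMinus m l k))}

/-- The algebra `ℂ[φ^±]` generated by the spinors `φ^{±(m,l,k)}` and their complex multiples.
It is only a real algebra: the product of `ℍ` is not complex bilinear. -/
def laurent : Subalgebra ℝ Spinor := Algebra.adjoin ℝ generators

/-- The subspace `ℂ[φ^±; N]` of elements which are homogeneous of order `N`,
`φ(z) = |z|^N φ(z/|z|)`. -/
def laurentHom (N : ℤ) : Submodule ℝ laurent where
  carrier := {φ | ∀ (z : Plane) (hz : z ≠ 0),
    (φ : Spinor) ⟨z, hz⟩ =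
      (‖z‖ ^ N : ℝ) • (φ : Spinor) ⟨(‖z‖⁻¹ : ℝ) • z, smul_ne_zero (inv_ne_zero (norm_ne_zero_iff.2 hz)) hz⟩}
  add_mem' := by
    intro a b ha hb z hz
    simp only [Set.mem_ofPred_eq] at ha hb
    simp [ha z hz, hb z hz]
  zero_mem' := by
    intro z hz
    simp
  smul_mem' := by
    intro c a ha z hz
    simp only [Set.mem_ofPred_eq] at ha
    simp [ha z hz, smul_smul, mul_comm]

/-! ### Differential operators -/

/-- Extension of a map on the punctured plane by `0`. -/
def ext0 {E : Type*} [Zero E] (f : Punctured → E) : Plane → E :=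
  open Classical in fun z => if h : z ≠ 0 then f ⟨z, h⟩ else 0

/-- The operator `∂/∂z_{j+1} = (∂/∂x_{j+1} - i ∂/∂y_{j+1}) / 2`. -/
def dz (j : Fin 2) (f : Punctured → ℂ) : Punctured → ℂ := fun z =>
  (1 / 2) * (lineDeriv ℝ (ext0 f) z (EuclideanSpace.single j 1) -
    Complex.I * lineDeriv ℝ (ext0 f) z (EuclideanSpace.single j Complex.I))

/-- The operator `∂/∂(conj z_{j+1}) = (∂/∂x_{j+1} + i ∂/∂y_{j+1}) / 2`. -/
def dzbar (j : Fin 2) (f : Punctured → ℂ) : Punctured → ℂ := fun z =>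
  (1 / 2) * (lineDeriv ℝ (ext0 f) z (EuclideanSpace.single j 1) +
    Complex.I * lineDeriv ℝ (ext0 f) z (EuclideanSpace.single j Complex.I))

/-- `θ = z₁ ∂/∂z₁ + z₂ ∂/∂z₂ - conj z₁ ∂/∂(conj z₁) - conj z₂ ∂/∂(conj z₂)`. -/
def thetaC (f : Punctured → ℂ) : Punctured → ℂ := fun z =>
  z.1 0 * dz 0 f z + z.1 1 * dz 1 f z
    - (starRingEnd ℂ) (z.1 0) * dzbar 0 f z - (starRingEnd ℂ) (z.1 1) * dzbar 1 f z

/-- `d₀ = (z₁ ∂/∂z₁ + z₂ ∂/∂z₂ + conj z₁ ∂/∂(conj z₁) + conj z₂ ∂/∂(conj z₂)) / 2`. -/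
def eulerC (f : Punctured → ℂ) : Punctured → ℂ := fun z =>
  (1 / 2) * (z.1 0 * dz 0 f z + z.1 1 * dz 1 f z
    + (starRingEnd ℂ) (z.1 0) * dzbar 0 f z + (starRingEnd ℂ) (z.1 1) * dzbar 1 f z)

/-- `Θ (u, v) = (θ u, θ v) / (2 i)`. -/
def Theta (φ : Spinor) : Spinor := fun z =>
  column (1 / (2 * Complex.I) * thetaC (fun w => fstC (φ w)) z)
    (1 / (2 * Complex.I) * thetaC (fun w => sndC (φ w)) z)

/-- `d₀ (u, v) = (d₀ u, d₀ v)`. -/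
def euler (φ : Spinor) : Spinor := fun z =>
  column (eulerC (fun w => fstC (φ w)) z) (eulerC (fun w => sndC (φ w)) z)

/-! ### Facts needed to see that `d₀` and the cocycle are (bi)linear on `ℂ[φ^±]` -/

theorem ext0_apply {E : Type*} [Zero E] (f : Punctured → E) {z : Plane} (h : z ≠ 0) :
    ext0 f z = f ⟨z, h⟩ := by
  simp [ext0, h]

/-- Smoothness on the punctured plane. -/
def IsSmooth {E : Type*} [NormedAddCommGroup E] [NormedSpace ℝ E] (f : Punctured → E) : Prop :=
  ContDiffOn ℝ ∞ (ext0 f) {0}ᶜ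

section smooth

variable {E F : Type*} [NormedAddCommGroup E] [NormedSpace ℝ E]
  [NormedAddCommGroup F] [NormedSpace ℝ F]

theorem isOpen_punctured : IsOpen ({0}ᶜ : Set Plane) := isOpen_compl_singleton

theorem IsSmooth.of_eq {f : Punctured → E} {g : Plane → E} (hg : ContDiffOn ℝ ∞ g {0}ᶜ)
    (h : ∀ z : Punctured, f z = g z) : IsSmooth f :=
  hg.congr fun z hz => by rw [ext0_apply f hz, h]

theorem IsSmooth.add {f g : Punctured → E} (hf : IsSmooth f) (hg : IsSmooth g) :
    IsSmooth (f + g) :=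
  IsSmooth.of_eq (ContDiffOn.add hf hg) fun z => by
    simp [ext0_apply _ z.2]

theorem IsSmooth.mul {f g : Spinor} (hf : IsSmooth f) (hg : IsSmooth g) :
    IsSmooth (f * g) :=
  IsSmooth.of_eq (ContDiffOn.mul hf hg) fun z => by
    simp [ext0_apply _ z.2]

theorem isSmooth_const (c : E) : IsSmooth (fun _ : Punctured => c) :=
  IsSmooth.of_eq contDiffOn_const fun _ => rfl

theorem IsSmooth.clm {f : Punctured → E} (hf : IsSmooth f) (L : E →L[ℝ] F) :
    IsSmooth (fun z => L (f z)) :=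
  IsSmooth.of_eq (L.contDiff.comp_contDiffOn hf) fun z => by
    simp [ext0_apply _ z.2]

theorem IsSmooth.differentiableAt {f : Punctured → E} (hf : IsSmooth f) (z : Punctured) :
    DifferentiableAt ℝ (ext0 f) z :=
  (ContDiffOn.contDiffAt hf (isOpen_punctured.mem_nhds z.2)).differentiableAt (by simp)

theorem eventually_ne (z : Punctured) : ∀ᶠ w in nhds (z : Plane), w ≠ 0 :=
  isOpen_punctured.mem_nhds z.2

/-- Two maps whose extensions agree near `z` up to a linear map. -/
theorem fderiv_clm {f : Punctured → E} (hf : IsSmooth f) (L : E →L[ℝ] F) (z : Punctured)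
    (v : Plane) : fderiv ℝ (ext0 fun w => L (f w)) z v = L (fderiv ℝ (ext0 f) z v) := by
  have h : (ext0 fun w => L (f w)) =ᶠ[nhds (z : Plane)] fun w => L (ext0 f w) := by
    filter_upwards [eventually_ne z] with w hw
    simp [ext0_apply _ hw]
  rw [h.fderiv_eq]
  have := (L.hasFDerivAt (x := ext0 f z)).comp (z : Plane) (hf.differentiableAt z).hasFDerivAt
  have h2 := this.fderiv
  simp only [Function.comp_def] at h2
  rw [h2]; rfl

theorem lineDeriv_eq {f : Punctured → E} (hf : IsSmooth f) (z : Punctured) (v : Plane) :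
    lineDeriv ℝ (ext0 f) z v = fderiv ℝ (ext0 f) z v :=
  (hf.differentiableAt z).lineDeriv_eq_fderiv

end smooth

/-- `fstC` as a real linear map. -/
def fstL : ℍ[ℝ] →L[ℝ] ℂ := LinearMap.toContinuousLinearMap
  { toFun := fstC
    map_add' := fun a b => by apply Complex.ext <;> simp [fstC]
    map_smul' := fun a b => by apply Complex.ext <;> simp [fstC] }

/-- `sndC` as a real linear map. -/
def sndL : ℍ[ℝ] →L[ℝ] ℂ := LinearMap.toContinuousLinearMap
  { toFun := sndC
    map_add' := fun a b => by apply Complex.ext <;> simp [sndC]; ring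
    map_smul' := fun a b => by apply Complex.ext <;> simp [sndC] }

/-- `column` as a real linear map. -/
def columnL : ℂ × ℂ →L[ℝ] ℍ[ℝ] := LinearMap.toContinuousLinearMap
  { toFun := fun p => column p.1 p.2
    map_add' := fun a b => by ext <;> simp; ring
    map_smul' := fun a b => by ext <;> simp }

theorem fstL_apply (q : ℍ[ℝ]) : fstL q = fstC q := rfl
theorem sndL_apply (q : ℍ[ℝ]) : sndL q = sndC q := rfl
theorem columnL_apply (p : ℂ × ℂ) : columnL p = column p.1 p.2 := rfl

theorem plane_decomp (z : Plane) : z =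
    (z 0).re • EuclideanSpace.single 0 (1 : ℂ) + (z 0).im • EuclideanSpace.single 0 Complex.I
    + (z 1).re • EuclideanSpace.single 1 (1 : ℂ)
    + (z 1).im • EuclideanSpace.single 1 Complex.I := by
  ext j
  fin_cases j <;> apply Complex.ext <;> simp

theorem plane_map (L : Plane →L[ℝ] ℂ) (z : Plane) : L z =
    (z 0).re • L (EuclideanSpace.single 0 (1 : ℂ)) + (z 0).im • L (EuclideanSpace.single 0 Complex.I)
    + (z 1).re • L (EuclideanSpace.single 1 (1 : ℂ))
    + (z 1).im • L (EuclideanSpace.single 1 Complex.I) := by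
  conv_lhs => rw [plane_decomp z]
  simp only [map_add, map_smul]

theorem eulerC_eq {f : Punctured → ℂ} (hf : IsSmooth f) (z : Punctured) :
    eulerC f z = (1 / 2 : ℝ) • fderiv ℝ (ext0 f) z z := by
  rw [plane_map]
  simp only [eulerC, dz, dzbar, lineDeriv_eq hf]
  apply Complex.ext <;> simp <;> ring

theorem thetaC_eq {f : Punctured → ℂ} (hf : IsSmooth f) (z : Punctured) :
    1 / (2 * Complex.I) * thetaC f z =
      (-1 / 2 : ℝ) • fderiv ℝ (ext0 f) z (Complex.I • (z : Plane)) := by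
  rw [plane_map]
  simp only [thetaC, dz, dzbar, lineDeriv_eq hf]
  apply Complex.ext <;> simp <;> ring

theorem euler_eq {φ : Spinor} (hφ : IsSmooth φ) (z : Punctured) :
    euler φ z = (1 / 2 : ℝ) • fderiv ℝ (ext0 φ) z z := by
  have h1 := eulerC_eq (hφ.clm fstL) z
  have h2 := eulerC_eq (hφ.clm sndL) z
  rw [fderiv_clm hφ, ← map_smul] at h1 h2
  simp only [fstL_apply, sndL_apply] at h1 h2
  rw [euler, h1, h2, column_fst_snd]

/-- On smooth spinors `Θ` is `-1/2` times the derivative along the field `i z`. -/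
theorem Theta_eq {φ : Spinor} (hφ : IsSmooth φ) (z : Punctured) :
    Theta φ z = (-1 / 2 : ℝ) • fderiv ℝ (ext0 φ) z (Complex.I • (z : Plane)) := by
  have h1 := thetaC_eq (hφ.clm fstL) z
  have h2 := thetaC_eq (hφ.clm sndL) z
  rw [fderiv_clm hφ, ← map_smul] at h1 h2
  simp only [fstL_apply, sndL_apply] at h1 h2
  rw [Theta, h1, h2, column_fst_snd]

/-! ### The generators are smooth and homogeneous -/

theorem eMinus_hom {p : Poly} {n : ℕ} (hp : p.IsHomogeneous n) : (eMinus p).IsHomogeneous n := by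
  rcases n with _ | n
  · rw [← MvPolynomial.totalDegree_zero_iff_isHomogeneous,
      MvPolynomial.totalDegree_eq_zero_iff_eq_C] at hp
    rw [hp]
    simp [eMinus, MvPolynomial.isHomogeneous_zero]
  · have h0 : (pzbar 1).IsHomogeneous 1 := MvPolynomial.isHomogeneous_X _ _
    have h1 : (pzbar 0).IsHomogeneous 1 := MvPolynomial.isHomogeneous_X _ _
    rw [add_comm]
    exact (h0.neg.mul hp.pderiv).add (h1.mul hp.pderiv)

theorem eHatMinus_hom {p : Poly} {n : ℕ} (hp : p.IsHomogeneous n) :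
    (eHatMinus p).IsHomogeneous n := by
  rcases n with _ | n
  · rw [← MvPolynomial.totalDegree_zero_iff_isHomogeneous,
      MvPolynomial.totalDegree_eq_zero_iff_eq_C] at hp
    rw [hp]
    simp [eHatMinus, MvPolynomial.isHomogeneous_zero]
  · have h0 : (pzbar 1).IsHomogeneous 1 := MvPolynomial.isHomogeneous_X _ _
    have h1 : (pz 0).IsHomogeneous 1 := MvPolynomial.isHomogeneous_X _ _
    rw [add_comm]
    exact (h0.mul hp.pderiv).sub (h1.mul hp.pderiv)

theorem vPoly_hom (k a b : ℕ) : (vPoly k a b).IsHomogeneous (a + b) := by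
  induction k with
  | zero =>
    have h0 : (pz 0).IsHomogeneous 1 := MvPolynomial.isHomogeneous_X _ _
    have h1 : (pz 1).IsHomogeneous 1 := MvPolynomial.isHomogeneous_X _ _
    simpa [vPoly] using (h0.pow a).mul (h1.pow b)
  | succ k ih =>
    rw [vPoly, Function.iterate_succ_apply']
    exact eMinus_hom ih

theorem wPoly_hom (k a b : ℕ) : (wPoly k a b).IsHomogeneous (a + b) := by
  induction k with
  | zero =>
    have h0 : (pz 1).IsHomogeneous 1 := MvPolynomial.isHomogeneous_X _ _
    have h1 : (pzbar 0).IsHomogeneous 1 := MvPolynomial.isHomogeneous_X _ _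
    simpa [wPoly] using (h0.pow a).mul (h1.pow b)
  | succ k ih =>
    rw [wPoly, Function.iterate_succ_apply']
    exact eHatMinus_hom ih

theorem polyEval_smul {p : Poly} {n : ℕ} (hp : p.IsHomogeneous n) (t : ℝ) (z : Plane) :
    polyEval p (t • z) = (t : ℂ) ^ n * polyEval p z := by
  have hx : ∀ i : Fin 2 ⊕ Fin 2,
      Sum.elim (fun j => (t • z) j) (fun j => (starRingEnd ℂ) ((t • z) j)) i =
        (t : ℂ) * Sum.elim (fun j => z j) (fun j => (starRingEnd ℂ) (z j)) i := by
    rintro (j | j) <;> simp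
  rw [polyEval, polyEval, MvPolynomial.eval_eq, MvPolynomial.eval_eq, Finset.mul_sum]
  refine Finset.sum_congr rfl fun d hd => ?_
  have hd' : d.degree = n := by
    rw [Finsupp.degree_eq_weight_one]
    exact hp (MvPolynomial.mem_support_iff.1 hd)
  simp only [hx, mul_pow, Finset.prod_mul_distrib, Finset.prod_pow_eq_pow_sum]
  have hd2 : ∑ i ∈ d.support, d i = n := hd'
  rw [hd2]
  ring

theorem polyEval_smooth (p : Poly) : ContDiff ℝ ∞ (polyEval p) := by
  induction p using MvPolynomial.induction_on with
  | C a =>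
    have : polyEval (MvPolynomial.C a) = fun _ => a := by
      funext z; simp [polyEval]
    rw [this]; exact contDiff_const
  | add p q hp hq =>
    have : polyEval (p + q) = fun z => polyEval p z + polyEval q z := by
      funext z; simp [polyEval]
    rw [this]; exact hp.add hq
  | mul_X p j hp =>
    have : polyEval (p * MvPolynomial.X j) = fun z => polyEval p z *
        Sum.elim (fun j => z j) (fun j => (starRingEnd ℂ) (z j)) j := by
      funext z; simp [polyEval]
    rw [this]
    refine hp.mul ?_
    rcases j with j | j
    · simp only [Sum.elim_inl]; fun_prop
    · simp only [Sum.elim_inr]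
      exact Complex.conjCLE.contDiff.comp (by fun_prop : ContDiff ℝ ∞ fun z : Plane => z j)

/-- Homogeneity of order `N` under positive dilations. -/
def IsHom (N : ℤ) (φ : Spinor) : Prop :=
  ∀ (t : ℝ) (ht : 0 < t) (z : Punctured),
    φ ⟨t • (z : Plane), smul_ne_zero ht.ne' z.2⟩ = (t ^ N : ℝ) • φ z

theorem cscale_smooth (c : ℂ) {φ : Spinor} (hφ : IsSmooth φ) : IsSmooth (cscale c φ) := by
  have h1 : IsSmooth (fun z => ((c * fstC (φ z), c * sndC (φ z)) : ℂ × ℂ)) :=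
    IsSmooth.of_eq (g := fun z => ((c * fstL (ext0 φ z), c * sndL (ext0 φ z)) : ℂ × ℂ))
      ((contDiffOn_const.mul (fstL.contDiff.comp_contDiffOn hφ)).prodMk
        (contDiffOn_const.mul (sndL.contDiff.comp_contDiffOn hφ)))
      fun z => by simp [ext0_apply _ z.2, fstL_apply, sndL_apply]
  exact h1.clm columnL

theorem cscale_hom (c : ℂ) {N : ℤ} {φ : Spinor} (hφ : IsHom N φ) : IsHom N (cscale c φ) := by
  intro t ht z
  simp only [cscale, hφ t ht z]
  ext <;> simp [fstC, sndC] <;> ring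

theorem phiPlus_smooth (m l k : ℕ) : IsSmooth (phiPlus m l k) := by
  have h1 : IsSmooth (fun z : Punctured =>
      (((normFactor m l k : ℂ) * ((k : ℂ) * polyEval (vPoly (k - 1) l (m - l)) z),
      (normFactor m l k : ℂ) * (-polyEval (vPoly k l (m - l)) z)) : ℂ × ℂ)) :=
    IsSmooth.of_eq (g := fun z : Plane =>
      (((normFactor m l k : ℂ) * ((k : ℂ) * polyEval (vPoly (k - 1) l (m - l)) z),
      (normFactor m l k : ℂ) * (-polyEval (vPoly k l (m - l)) z)) : ℂ × ℂ))
      (ContDiff.contDiffOn ((contDiff_const.mul (contDiff_const.mul (polyEval_smooth _))).prodMk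
        (contDiff_const.mul (polyEval_smooth _).neg))) fun z => rfl
  exact h1.clm columnL

theorem radial_smooth (n : ℕ) :
    ContDiffOn ℝ ∞ (fun z : Plane => (((1 / ‖z‖ ^ 2) ^ n : ℝ) : ℂ)) {0}ᶜ := by
  refine Complex.ofRealCLM.contDiff.comp_contDiffOn ?_
  refine ContDiffOn.pow ?_ n
  refine contDiffOn_const.div (contDiff_norm_sq ℝ).contDiffOn ?_
  intro z hz
  have : z ≠ 0 := hz
  positivity

theorem phiMinus_smooth (m l k : ℕ) : IsSmooth (phiMinus m l k) := by
  have h1 : IsSmooth (fun z : Punctured =>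
      (((normFactor m l k : ℂ) * ((((1 / ‖(z : Plane)‖ ^ 2) ^ (m + 2) : ℝ) : ℂ) *
        polyEval (wPoly k (m + 1 - l) l) z),
      (normFactor m l k : ℂ) * ((((1 / ‖(z : Plane)‖ ^ 2) ^ (m + 2) : ℝ) : ℂ) *
        polyEval (wPoly k (m - l) (l + 1)) z)) : ℂ × ℂ)) :=
    IsSmooth.of_eq (g := fun z : Plane =>
      (((normFactor m l k : ℂ) * ((((1 / ‖z‖ ^ 2) ^ (m + 2) : ℝ) : ℂ) *
        polyEval (wPoly k (m + 1 - l) l) z),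
      (normFactor m l k : ℂ) * ((((1 / ‖z‖ ^ 2) ^ (m + 2) : ℝ) : ℂ) *
        polyEval (wPoly k (m - l) (l + 1)) z)) : ℂ × ℂ))
      ((contDiffOn_const.mul ((radial_smooth _).mul (polyEval_smooth _).contDiffOn)).prodMk
        (contDiffOn_const.mul ((radial_smooth _).mul (polyEval_smooth _).contDiffOn)))
      fun z => rfl
  exact h1.clm columnL

theorem column_smul (t : ℝ) (a b : ℂ) : t • column a b = column (t * a) (t * b) := by
  ext <;> simp

theorem phiPlus_hom {m l : ℕ} (k : ℕ) (hl : l ≤ m) : IsHom m (phiPlus m l k) := by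
  intro t ht z
  have h1 := vPoly_hom (k - 1) l (m - l)
  have h2 := vPoly_hom k l (m - l)
  rw [Nat.add_sub_cancel' hl] at h1 h2
  simp only [phiPlus, polyEval_smul h1, polyEval_smul h2, column_smul]
  congr 1 <;> push_cast <;> simp <;> ring

theorem phiMinus_hom {m l : ℕ} (k : ℕ) (hl : l ≤ m) : IsHom (-(m + 3)) (phiMinus m l k) := by
  intro t ht z
  have h1 := wPoly_hom k (m + 1 - l) l
  have h2 := wPoly_hom k (m - l) (l + 1)
  rw [show m + 1 - l + l = m + 1 by omega] at h1
  rw [show m - l + (l + 1) = m + 1 by omega] at h2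
  have ht' : (t : ℂ) ≠ 0 := by exact_mod_cast ht.ne'
  have key : (((1 / ‖t • (z : Plane)‖ ^ 2) ^ (m + 2) : ℝ) : ℂ) * (t : ℂ) ^ (m + 1) =
      ((t ^ (-(m + 3) : ℤ) : ℝ) : ℂ) * (((1 / ‖(z : Plane)‖ ^ 2) ^ (m + 2) : ℝ) : ℂ) := by
    rw [norm_smul, Real.norm_of_nonneg ht.le]
    have hz : ‖(z : Plane)‖ ≠ 0 := norm_ne_zero_iff.2 z.2
    have hm : (t ^ (-(m + 3) : ℤ) : ℝ) = (t ^ (m + 3))⁻¹ := by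
      rw [zpow_neg]; norm_cast
    rw [hm, ← Complex.ofReal_pow, ← Complex.ofReal_mul, ← Complex.ofReal_mul]
    congr 1
    have ht0 : t ≠ 0 := ht.ne'
    have e : t ^ (m + 3) * t ^ (m + 1) = (t ^ 2) ^ (m + 2) := by ring
    rw [inv_mul_eq_div, eq_div_iff (by positivity), mul_assoc, mul_comm (t ^ (m + 1)), e,
      ← mul_pow]
    congr 1
    field_simp
  simp only [phiMinus, polyEval_smul h1, polyEval_smul h2, column_smul]
  congr 1
  · linear_combination (normFactor m l k : ℂ) * polyEval (wPoly k (m + 1 - l) l) z * key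
  · linear_combination (normFactor m l k : ℂ) * polyEval (wPoly k (m - l) (l + 1)) z * key

/-- Euler's identity. -/
theorem euler_of_hom {N : ℤ} {φ : Spinor} (hs : IsSmooth φ) (hφ : IsHom N φ) :
    euler φ = ((N : ℝ) / 2) • φ := by
  funext z
  rw [euler_eq hs, Pi.smul_apply]
  have h1 : HasDerivAt (fun t : ℝ => t • (z : Plane)) (z : Plane) 1 := by
    simpa using (hasDerivAt_id (1 : ℝ)).smul_const (z : Plane)
  have hd : HasFDerivAt (ext0 φ) (fderiv ℝ (ext0 φ) z) ((1 : ℝ) • (z : Plane)) := by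
    rw [one_smul]; exact (hs.differentiableAt z).hasFDerivAt
  have h2 := hd.comp_hasDerivAt (1 : ℝ) h1
  have h3 : HasDerivAt (fun t : ℝ => (t ^ N : ℝ) • φ z) (((N : ℝ) * 1 ^ (N - 1)) • φ z) 1 :=
    (hasDerivAt_zpow N 1 (Or.inl one_ne_zero)).smul_const _
  have h4 : (ext0 φ ∘ fun t : ℝ => t • (z : Plane)) =ᶠ[nhds 1] fun t : ℝ => (t ^ N : ℝ) • φ z := by
    filter_upwards [lt_mem_nhds (zero_lt_one' ℝ)] with t ht
    rw [← hφ t ht z]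
    exact ext0_apply _ _
  have h5 := h2.unique (h3.congr_of_eventuallyEq h4)
  rw [h5, one_zpow, mul_one, smul_smul]
  congr 1
  ring

theorem euler_add {φ ψ : Spinor} (hφ : IsSmooth φ) (hψ : IsSmooth ψ) :
    euler (φ + ψ) = euler φ + euler ψ := by
  funext z
  rw [Pi.add_apply, euler_eq hφ, euler_eq hψ, euler_eq (hφ.add hψ)]
  have : ext0 (φ + ψ) = ext0 φ + ext0 ψ := by
    funext w; by_cases hw : w = 0 <;> simp [ext0, hw]
  rw [this, fderiv_add (hφ.differentiableAt z) (hψ.differentiableAt z)]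
  simp

theorem Theta_add {φ ψ : Spinor} (hφ : IsSmooth φ) (hψ : IsSmooth ψ) :
    Theta (φ + ψ) = Theta φ + Theta ψ := by
  funext z
  rw [Pi.add_apply, Theta_eq hφ, Theta_eq hψ, Theta_eq (hφ.add hψ)]
  have : ext0 (φ + ψ) = ext0 φ + ext0 ψ := by
    funext w; by_cases hw : w = 0 <;> simp [ext0, hw]
  rw [this, fderiv_add (hφ.differentiableAt z) (hψ.differentiableAt z)]
  simp

theorem IsSmooth.smul {φ : Spinor} (hφ : IsSmooth φ) (r : ℝ) : IsSmooth (r • φ) :=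
  IsSmooth.of_eq (ContDiffOn.const_smul r hφ) fun z => by simp [ext0_apply _ z.2]

theorem euler_smul {φ : Spinor} (hφ : IsSmooth φ) (r : ℝ) : euler (r • φ) = r • euler φ := by
  funext z
  rw [Pi.smul_apply, euler_eq hφ, euler_eq (hφ.smul r)]
  have : ext0 (r • φ) = r • ext0 φ := by
    funext w; by_cases hw : w = 0 <;> simp [ext0, hw]
  rw [this, fderiv_const_smul (hφ.differentiableAt z)]
  simp [smul_comm r]

theorem Theta_smul {φ : Spinor} (hφ : IsSmooth φ) (r : ℝ) : Theta (r • φ) = r • Theta φ := by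
  funext z
  rw [Pi.smul_apply, Theta_eq hφ, Theta_eq (hφ.smul r)]
  have : ext0 (r • φ) = r • ext0 φ := by
    funext w; by_cases hw : w = 0 <;> simp [ext0, hw]
  rw [this, fderiv_const_smul (hφ.differentiableAt z)]
  simp [smul_comm r]

theorem euler_mul {φ ψ : Spinor} (hφ : IsSmooth φ) (hψ : IsSmooth ψ) :
    euler (φ * ψ) = euler φ * ψ + φ * euler ψ := by
  funext z
  rw [Pi.add_apply, Pi.mul_apply, Pi.mul_apply, euler_eq hφ, euler_eq hψ, euler_eq (hφ.mul hψ)]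
  have : ext0 (φ * ψ) = ext0 φ * ext0 ψ := by
    funext w; by_cases hw : w = 0 <;> simp [ext0, hw]
  rw [this, fderiv_mul' (hφ.differentiableAt z) (hψ.differentiableAt z)]
  simp [ext0_apply _ z.2, add_comm]

theorem generators_smooth {φ : Spinor} (h : φ ∈ generators) : IsSmooth φ := by
  obtain ⟨c, m, l, k, -, -, rfl | rfl⟩ := h
  · exact cscale_smooth c (phiPlus_smooth m l k)
  · exact cscale_smooth c (phiMinus_smooth m l k)

theorem generators_hom {φ : Spinor} (h : φ ∈ generators) : ∃ N : ℤ, IsHom N φ := by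
  obtain ⟨c, m, l, k, hl, -, rfl | rfl⟩ := h
  · exact ⟨_, cscale_hom c (phiPlus_hom k hl)⟩
  · exact ⟨_, cscale_hom c (phiMinus_hom k hl)⟩

theorem laurent_smooth {φ : Spinor} (h : φ ∈ laurent) : IsSmooth φ := by
  induction h using Algebra.adjoin_induction with
  | mem φ h => exact generators_smooth h
  | algebraMap r => exact isSmooth_const (algebraMap ℝ ℍ[ℝ] r)
  | add φ ψ _ _ h1 h2 => exact h1.add h2
  | mul φ ψ _ _ h1 h2 => exact h1.mul h2

theorem euler_mem {φ : Spinor} (h : φ ∈ laurent) : euler φ ∈ laurent := by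
  induction h using Algebra.adjoin_induction with
  | mem φ h =>
    obtain ⟨N, hN⟩ := generators_hom h
    rw [euler_of_hom (generators_smooth h) hN]
    exact laurent.smul_mem (Algebra.subset_adjoin h) _
  | algebraMap r =>
    have h0 : IsHom 0 (algebraMap ℝ Spinor r) := by
      intro t ht z
      simp [Pi.algebraMap_apply]
    have h1 : IsSmooth (algebraMap ℝ Spinor r) := isSmooth_const (algebraMap ℝ ℍ[ℝ] r)
    rw [euler_of_hom h1 h0]
    simp
  | add φ ψ hφ hψ h1 h2 =>
    rw [euler_add (laurent_smooth hφ) (laurent_smooth hψ)]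
    exact laurent.add_mem h1 h2
  | mul φ ψ hφ hψ h1 h2 =>
    rw [euler_mul (laurent_smooth hφ) (laurent_smooth hψ)]
    exact laurent.add_mem (laurent.mul_mem h1 hψ) (laurent.mul_mem hφ h2)

/-! ### The derivation `d₀` and the cocycle `c` on `ℂ[φ^±]` -/

/-- `d₀` acting on `ℂ[φ^±]`. -/
def d0 : laurent →ₗ[ℝ] laurent where
  toFun φ := ⟨euler φ, euler_mem φ.2⟩
  map_add' φ ψ := Subtype.ext (euler_add (laurent_smooth φ.2) (laurent_smooth ψ.2))
  map_smul' r φ := Subtype.ext (euler_smul (laurent_smooth φ.2) r)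

/-- A point of the unit sphere as a point of the punctured plane. -/
def ofSphere (z : Metric.sphere (0 : Plane) 1) : Punctured :=
  ⟨z, fun h => by simpa [h] using z.2⟩

/-- Surface measure of the unit sphere `S³ ⊂ ℂ²` (total mass `2 π²`). -/
def surfaceMeasure : MeasureTheory.Measure (Metric.sphere (0 : Plane) 1) :=
  (MeasureTheory.volume : MeasureTheory.Measure Plane).toSphere

/-- The integral `(1 / 2π²) ∫_{S³} tr (Θ φ₁ · φ₂) dσ`. -/
def cocycleFun (φ₁ φ₂ : Spinor) : ℝ :=
  1 / (2 * Real.pi ^ 2) *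
    ∫ z, quatTr (Theta φ₁ (ofSphere z) * φ₂ (ofSphere z)) ∂surfaceMeasure

theorem continuous_ofSphere : Continuous ofSphere :=
  continuous_subtype_val.subtype_mk _

theorem IsSmooth.continuous {φ : Spinor} (h : IsSmooth φ) : Continuous φ := by
  have := continuousOn_iff_continuous_domRestrict.1 (ContDiffOn.continuousOn h)
  refine this.congr fun z => ?_
  exact ext0_apply φ z.2

theorem IsSmooth.continuous_Theta {φ : Spinor} (h : IsSmooth φ) : Continuous (Theta φ) := by
  have h1 := h.continuousOn_fderiv_of_isOpen isOpen_punctured (by simp)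
  have h2 := continuousOn_iff_continuous_domRestrict.1 h1
  have h3 : Continuous fun z : Punctured => fderiv ℝ (ext0 φ) z (Complex.I • (z : Plane)) :=
    h2.clm_apply (continuous_subtype_val.const_smul Complex.I)
  have h4 : Continuous fun z : Punctured =>
      (-1 / 2 : ℝ) • fderiv ℝ (ext0 φ) z (Complex.I • (z : Plane)) := by
    fun_prop
  exact h4.congr fun z => (Theta_eq h z).symm

theorem cocycle_integrable {φ ψ : Spinor} (hφ : IsSmooth φ) (hψ : IsSmooth ψ) :
    MeasureTheory.Integrable
      (fun z => quatTr (Theta φ (ofSphere z) * ψ (ofSphere z))) surfaceMeasure := by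
  have hc : Continuous fun z => quatTr (Theta φ (ofSphere z) * ψ (ofSphere z)) := by
    unfold quatTr
    exact continuous_const.mul (Quaternion.continuous_re.comp
      ((hφ.continuous_Theta.comp continuous_ofSphere).mul (hψ.continuous.comp continuous_ofSphere)))
  have : MeasureTheory.IsFiniteMeasure surfaceMeasure := by
    unfold surfaceMeasure; infer_instance
  exact hc.integrable_of_hasCompactSupport (HasCompactSupport.of_compactSpace _)

/-- The cocycle `c(φ₁, φ₂) = (1 / 2π²) ∫_{S³} tr (Θ φ₁ · φ₂) dσ` on `ℂ[φ^±]`. -/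
def cocycle : LinearMap.BilinForm ℝ laurent :=
  LinearMap.mk₂ ℝ (fun φ₁ φ₂ => cocycleFun φ₁ φ₂)
    (fun φ φ' ψ => by
      have h := MeasureTheory.integral_add
        (cocycle_integrable (laurent_smooth φ.2) (laurent_smooth ψ.2))
        (cocycle_integrable (laurent_smooth φ'.2) (laurent_smooth ψ.2))
      simp only [cocycleFun, Subalgebra.coe_add,
        Theta_add (laurent_smooth φ.2) (laurent_smooth φ'.2)]
      rw [← mul_add, ← h]
      congr 2
      funext z
      simp [quatTr, add_mul]
      ring)
    (fun r φ ψ => by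
      simp only [cocycleFun, Subalgebra.coe_smul, Theta_smul (laurent_smooth φ.2)]
      rw [smul_eq_mul, mul_left_comm, ← MeasureTheory.integral_const_mul r]
      congr 2
      funext z
      simp [quatTr]
      ring)
    (fun φ ψ ψ' => by
      have h := MeasureTheory.integral_add
        (cocycle_integrable (laurent_smooth φ.2) (laurent_smooth ψ.2))
        (cocycle_integrable (laurent_smooth φ.2) (laurent_smooth ψ'.2))
      simp only [cocycleFun, Subalgebra.coe_add]
      rw [← mul_add, ← h]
      congr 2
      funext z
      simp only [Pi.add_apply, quatTr, mul_add, Quaternion.re_add])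
    (fun r φ ψ => by
      simp only [cocycleFun, Subalgebra.coe_smul]
      rw [smul_eq_mul, mul_left_comm, ← MeasureTheory.integral_const_mul r]
      congr 2
      funext z
      simp [quatTr]
      ring)

/-- The constant spinor `φ^{+(0,0,1)} = (1, 0)`, as an element of `ℂ[φ^±]`. -/
def phi001 : laurent :=
  ⟨phiPlus 0 0 1, Algebra.subset_adjoin ⟨1, 0, 0, 1, le_rfl, le_rfl, Or.inl (by
    funext z; simp [cscale, column_fst_snd])⟩⟩

/-! ### The algebra `ĝ` -/

section ghat

variable (g : Type*) [LieRing g] [LieAlgebra ℂ g]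

/-- The enveloping algebra `U(g)`. -/
abbrev Env : Type _ := UniversalEnvelopingAlgebra ℂ g

/-- The tensor product `ℂ[φ^±] ⊗ U(g)` over `ℝ`, an associative complex algebra; complex scalars
act on `U(g)`, which is written as the left factor: `φ ⊗ X` is `X ⊗ₜ φ`. -/
abbrev Current : Type _ := Env g ⊗[ℝ] laurent

/-- The complex vector space `ĝ = (ℂ[φ^±] ⊗ U(g)) ⊕ ℂ a ⊕ ℂ d`; the triple `(ξ, s, t)` is
`ξ + s a + t d`. -/
abbrev Ghat : Type _ := Current g × ℂ × ℂ

/-- The canonical map `g → U(g)`. -/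
def iota : g →ₗ[ℂ] Env g where
  toFun X := UniversalEnvelopingAlgebra.ι ℂ X
  map_add' X Y := by
    let _ : LieRing (Env g) := LieRing.ofAssociativeRing
    exact map_add (UniversalEnvelopingAlgebra.ι ℂ (L := g)) X Y
  map_smul' c X := by
    let _ : LieRing (Env g) := LieRing.ofAssociativeRing
    exact map_smul (UniversalEnvelopingAlgebra.ι ℂ (L := g)) c X

/-- Extension of the adjoint representation of `g` on itself to `U(g)`. -/
def adEnv : Env g →ₐ[ℂ] Module.End ℂ g := UniversalEnvelopingAlgebra.lift ℂ (LieAlgebra.ad ℂ g)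

/-- The invariant form `(X | Y) = tr (ad X ∘ ad Y)` on `U(g)`. -/
def envForm : LinearMap.BilinForm ℂ (Env g) :=
  ((LinearMap.mul ℂ (Module.End ℂ g)).compl₁₂ (adEnv g).toLinearMap (adEnv g).toLinearMap).compr₂
    (LinearMap.trace ℂ g)

theorem envForm_apply (X Y : Env g) :
    envForm g X Y = LinearMap.trace ℂ g (adEnv g X * adEnv g Y) := rfl

/-- The cocycle on `ℂ[φ^±] ⊗ U(g)`: `c(φ ⊗ X, ψ ⊗ Y) = (X | Y) c(φ, ψ)`. -/
def currentCocycle : LinearMap.BilinForm ℂ (Current g) :=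
  LinearMap.BilinForm.tmul (envForm g) cocycle

theorem currentCocycle_tmul (X Y : Env g) (φ ψ : laurent) :
    currentCocycle g (X ⊗ₜ φ) (Y ⊗ₜ ψ) = envForm g X Y * (cocycle φ ψ : ℂ) := by
  simp [currentCocycle, mul_comm]

/-- The action `φ ⊗ X ↦ d₀ φ ⊗ X` of `d` on `ℂ[φ^±] ⊗ U(g)`. -/
def dCurrent : Current g →ₗ[ℂ] Current g :=
  TensorProduct.AlgebraTensorModule.map LinearMap.id d0

theorem dCurrent_tmul (X : Env g) (φ : laurent) : dCurrent g (X ⊗ₜ φ) = X ⊗ₜ d0 φ := rfl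

/-- The commutator of `ℂ[φ^±] ⊗ U(g)`. -/
def currentBracket : Current g →ₗ[ℂ] Current g →ₗ[ℂ] Current g :=
  LinearMap.mul ℂ (Current g) - (LinearMap.mul ℂ (Current g)).flip

theorem currentBracket_tmul (X Y : Env g) (φ ψ : laurent) :
    currentBracket g (X ⊗ₜ φ) (Y ⊗ₜ ψ) = (X * Y) ⊗ₜ (φ * ψ) - (Y * X) ⊗ₜ (ψ * φ) := by
  simp [currentBracket]

/-- The bracket of `ĝ`:
`[ξ₁ + s₁ a + t₁ d, ξ₂ + s₂ a + t₂ d] = [ξ₁, ξ₂] + t₁ d₀ ξ₂ - t₂ d₀ ξ₁ + c(ξ₁, ξ₂) a`. -/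
def ghatBracket : Ghat g →ₗ[ℂ] Ghat g →ₗ[ℂ] Ghat g :=
  LinearMap.mk₂ ℂ
    (fun ξ η => (currentBracket g ξ.1 η.1 + ξ.2.2 • dCurrent g η.1 - η.2.2 • dCurrent g ξ.1,
      currentCocycle g ξ.1 η.1, 0))
    (fun ξ ξ' η => by
      ext1
      · simp only [Prod.fst_add, Prod.snd_add, map_add, LinearMap.add_apply]; module
      · simp)
    (fun c ξ η => by
      ext1
      · simp only [Prod.smul_fst, Prod.smul_snd, map_smul, LinearMap.smul_apply, smul_eq_mul]
        module
      · simp)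
    (fun ξ η η' => by
      ext1
      · simp only [Prod.fst_add, Prod.snd_add, map_add]; module
      · simp)
    (fun c ξ η => by
      ext1
      · simp only [Prod.smul_fst, Prod.smul_snd, map_smul, smul_eq_mul]
        module
      · simp)

variable {g}
variable (H : LieSubalgebra ℂ g)

/-- `ĥ = h ⊕ ℂ a ⊕ ℂ d`; the triple `(h, s, t)` is `h + s a + t d`. -/
abbrev Hhat : Type _ := H × ℂ × ℂ

/-- The map `h + s a + t d ↦ φ^{+(0,0,1)} ⊗ h + s a + t d` from `ĥ` to `ĝ`. -/
def hhatIncl : Hhat H →ₗ[ℂ] Ghat g :=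
  LinearMap.prodMap
    (((TensorProduct.AlgebraTensorModule.mk ℝ ℂ (Env g) laurent).flip phi001).comp
      ((iota g).comp H.toSubmodule.subtype))
    LinearMap.id

/-- The functional `δ` on `ĥ`: `δ(h) = δ(a) = 0`, `δ(d) = 1`. -/
def delta : Module.Dual ℂ (Hhat H) := (LinearMap.snd ℂ ℂ ℂ).comp (LinearMap.snd ℂ H (ℂ × ℂ))

variable {H}

/-- A functional on `h` extended to `ĥ` by `0` on `a` and `d`. -/
def extendDual (lam : Module.Dual ℂ H) : Module.Dual ℂ (Hhat H) :=
  lam.comp (LinearMap.fst ℂ H (ℂ × ℂ))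

/-- The weight space `g^U_λ = {X ∈ U(g) ; h X - X h = λ(h) X for all h ∈ h}`. -/
def envWeightSpace (lam : Module.Dual ℂ H) : Submodule ℂ (Env g) where
  carrier := {X | ∀ h : H, iota g h * X - X * iota g h = lam h • X}
  add_mem' := by
    intro X Y hX hY h
    rw [smul_add, ← hX h, ← hY h]
    noncomm_ring
  zero_mem' := by intro h; simp
  smul_mem' := by
    intro c X hX h
    rw [smul_comm, ← hX h, smul_sub, mul_smul_comm, smul_mul_assoc]

/-- The weight space `ĝ_μ = {ξ ∈ ĝ ; [ĥ, ξ] = μ(ĥ) ξ for all ĥ ∈ ĥ}`. -/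
def ghatWeightSpace (mu : Module.Dual ℂ (Hhat H)) : Submodule ℂ (Ghat g) where
  carrier := {ξ | ∀ k : Hhat H, ghatBracket g (hhatIncl H k) ξ = mu k • ξ}
  add_mem' := by
    intro ξ η hξ hη k
    rw [map_add, hξ k, hη k, smul_add]
  zero_mem' := by intro k; simp
  smul_mem' := by
    intro c ξ hξ k
    rw [map_smul, hξ k, smul_comm]

variable (H)

/-- The roots of `g` with respect to `h`. -/
def roots : Set (Module.Dual ℂ H) :=
  {α | α ≠ 0 ∧ ∃ X : g, X ≠ 0 ∧ ∀ h : H, ⁅(h : g), X⁆ = α h • X}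

/-- The root lattice `Σ`. -/
def rootLattice : Submodule ℤ (Module.Dual ℂ H) := Submodule.span ℤ (roots H)

variable {H}

/-- The subspace `ℂ[φ^±; m] ⊗ V` of `ℂ[φ^±] ⊗ U(g)`, for a subspace `V` of `U(g)`. -/
def homTensor (m : ℤ) (V : Submodule ℂ (Env g)) :
    Submodule ℂ (Current g) :=
  LinearMap.range (TensorProduct.AlgebraTensorModule.map V.subtype (laurentHom m).subtype)

end ghat

end

end QuatCurrent

open QuatCurrent

namespace QuatCurrent

/-! The spinor `phi001` is the constant `1`. It is central in `laurent`, `d0` kills it, and `Theta`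
kills it, so the cocycle vanishes against it. Hence an element h + s a + t d of ĥ acts on `Current
g` as ad h on the factor U(g) plus t `d0` on the factor `laurent`, and it kills ℂa ⊕ ℂd. On ℂ[φ^±;
m] ⊗ g^U_λ Euler's identity turns this into the scalar (m/2)δ + λ. These subspaces, with ℂa ⊕ ℂd
added at weight zero, form the family `weightPart`.

Two facts then identify all weight spaces at once. The family spans ĝ: `laurent` is generated by
homogeneous spinors and U(g) by root vectors and h, and the graded pieces of either algebra multiply
compatibly (`iSup_laurentHom_eq_top`, `iSup_envWeightSpace_eq_top`). Joint eigenspaces for distinct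
characters are independent, so subspaces that span and lie in joint eigenspaces for distinct
characters exhaust them, and no other character occurs (`jointEigenspace_eq_of_iSup_eq_top`,
`jointEigenspace_eq_bot_of_iSup_eq_top`).

It remains to see that every piece is nonzero. For `laurent`, products of two generators of degrees
1 and -3 reach every integer degree and do not vanish, because ℍ is a division ring
(`exists_mem_laurentHom_ne_zero`). For U(g), every element of the root lattice is a sum of roots,
and the corresponding product of root vectors is nonzero. This is shown without a PBW basis, by
letting U(g) act on polynomials on the dual of g (`list_prod_iota_ne_zero`). -/

/-! ### Joint eigenspaces -/

section joint

variable {K V κ ι : Type*} [Field K] [AddCommGroup V] [Module K V]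

/-- The joint eigenspace of a family of endomorphisms. -/
def jointEigenspace (T : κ → Module.End K V) (χ : κ → K) : Submodule K V :=
  ⨅ k, (T k).eigenspace (χ k)

theorem mem_jointEigenspace {T : κ → Module.End K V} {χ : κ → K} {v : V} :
    v ∈ jointEigenspace T χ ↔ ∀ k, T k v = χ k • v := by
  simp [jointEigenspace]

/-- The operators need not commute: as for eigenvectors of a single operator, one eigenvector is
eliminated at a time, using an operator `T k` that separates two characters. -/
theorem eq_zero_of_sum_jointEigenspace (T : κ → Module.End K V) {χ : ι → κ → K}
    (hχ : Function.Injective χ) (s : Finset ι) (v : ι → V)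
    (hv : ∀ i ∈ s, v i ∈ jointEigenspace T (χ i)) (h0 : ∑ i ∈ s, v i = 0) :
    ∀ i ∈ s, v i = 0 := by
  classical
  induction s using Finset.induction_on generalizing v with
  | empty => simp
  | insert a s ha ih =>
    have hs : ∀ i ∈ s, v i = 0 := by
      intro i hi
      have hia : χ i ≠ χ a := fun h => ha (hχ h ▸ hi)
      obtain ⟨k, hk⟩ := Function.ne_iff.1 hia
      -- Applying `T k - χ a k` to the relation removes the term of index `a` and rescales the
      -- others; the coefficient of `v i` is nonzero by the choice of `k`.
      have h1 := ih (fun j => (χ j k - χ a k) • v j)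
        (fun j hj => Submodule.smul_mem _ _ (hv j (Finset.mem_insert_of_mem hj))) (by
          have h2 := congrArg (T k) h0
          rw [map_sum, map_zero, Finset.sum_insert ha,
            mem_jointEigenspace.1 (hv a (Finset.mem_insert_self a s)) k] at h2
          rw [Finset.sum_insert ha] at h0
          have h3 : ∑ j ∈ s, T k (v j) = ∑ j ∈ s, χ j k • v j :=
            Finset.sum_congr rfl fun j hj =>
              mem_jointEigenspace.1 (hv j (Finset.mem_insert_of_mem hj)) k
          rw [h3] at h2
          simp only [sub_smul, Finset.sum_sub_distrib, ← Finset.smul_sum]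
          rw [eq_neg_of_add_eq_zero_right h0, ← h2]
          module) i hi
      exact (smul_eq_zero.1 h1).resolve_left (sub_ne_zero.2 hk)
    intro i hi
    rcases Finset.mem_insert.1 hi with rfl | hi
    · rwa [Finset.sum_insert ha, Finset.sum_eq_zero hs, add_zero] at h0
    · exact hs i hi

theorem iSupIndep_jointEigenspace (T : κ → Module.End K V) {χ : ι → κ → K}
    (hχ : Function.Injective χ) : iSupIndep fun i => jointEigenspace T (χ i) := by
  classical
  rw [iSupIndep_iff_finsetSum_eq_zero_imp_eq_zero]
  intro s v hv h0
  exact eq_zero_of_sum_jointEigenspace T hχ s v hv h0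

variable {T : κ → Module.End K V} {χ : ι → κ → K} {W : ι → Submodule K V}

/-- Split a joint eigenvector as a part in `W i` plus a part in the other `W j`. The second part is
again in the joint eigenspace of `χ i`, so it vanishes by independence. -/
theorem jointEigenspace_eq_of_iSup_eq_top (hχ : Function.Injective χ)
    (hW : ∀ i, W i ≤ jointEigenspace T (χ i)) (htop : ⨆ i, W i = ⊤) (i : ι) :
    jointEigenspace T (χ i) = W i := by
  refine le_antisymm (fun x hx => ?_) (hW i)
  have hx' : x ∈ W i ⊔ ⨆ j, ⨆ _ : j ≠ i, W j := by
    have : W i ⊔ ⨆ j, ⨆ _ : j ≠ i, W j = ⊤ := by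
      rw [eq_top_iff, ← htop]
      refine iSup_le fun j => ?_
      by_cases h : j = i
      · subst h; exact le_sup_left
      · exact le_sup_of_le_right (le_iSup₂_of_le j h le_rfl)
    rw [this]; trivial
  obtain ⟨w, hw, y, hy, rfl⟩ := Submodule.mem_sup.1 hx'
  have hy1 : y ∈ jointEigenspace T (χ i) := by
    simpa using Submodule.sub_mem _ hx (hW i hw)
  have hy2 := iSup₂_mono (fun j (_ : j ≠ i) => hW j) hy
  have := Submodule.disjoint_def.1 (iSupIndep_jointEigenspace T hχ i) y hy1 hy2
  rw [this, add_zero]; exact hw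

theorem jointEigenspace_eq_bot_of_iSup_eq_top
    (hW : ∀ i, W i ≤ jointEigenspace T (χ i)) (htop : ⨆ i, W i = ⊤)
    {ψ : κ → K} (hψ : ∀ i, χ i ≠ ψ) : jointEigenspace T ψ = ⊥ := by
  -- Indexing by all characters makes `ψ` comparable with every `χ i`; no injectivity of `χ` is
  -- required.
  have h := iSupIndep_jointEigenspace T (χ := fun ψ : κ → K => ψ) (fun _ _ h => h) ψ
  rw [← disjoint_top]
  refine h.mono_right ?_
  rw [← htop]
  exact iSup_le fun i => (hW i).trans (le_iSup₂_of_le (χ i) (hψ i) le_rfl)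

end joint

/-! ### Products of vector fields -/

/-- At a zero of f, applying n derivations to f^n leaves only the terms in which each derivation
hits a different factor f, which add up to n! times the product of the `D f`. The extra exponent `m`
makes the induction run, since the outermost derivation consumes one more factor; in general c =
(n+m)!/m!. -/
theorem list_prod_derivation_apply_pow {K S : Type*} [CommRing K] [CommRing S] [Algebra K S]
    (l : List (Derivation K S S)) (f : S) (m : ℕ) :
    ∃ (c : ℕ) (r : S), c ≠ 0 ∧
      (l.map fun D : Derivation K S S => (D.toLinearMap : Module.End K S)).prod (f ^ (l.length + m)) =
        c * f ^ m * (l.map fun D : Derivation K S S => D f).prod + f ^ (m + 1) * r := by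
  induction l generalizing m with
  | nil => exact ⟨1, 0, one_ne_zero, by simp⟩
  | cons D l ih =>
    obtain ⟨c, r, hc, h⟩ := ih (m + 1)
    refine ⟨c * (m + 1), c * D (l.map fun D : Derivation K S S => D f).prod + (m + 2) * D f * r + f * D r,
      by positivity, ?_⟩
    rw [List.map_cons, List.prod_cons, Module.End.mul_apply, List.length_cons,
      show l.length + 1 + m = l.length + (m + 1) by ring, h]
    change D _ = _
    simp only [map_add, Nat.add_sub_cancel, Derivation.leibniz, Derivation.leibniz_pow,
      Derivation.map_natCast, smul_eq_mul, nsmul_eq_mul, List.map_cons, List.prod_cons]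
    push_cast
    ring

section linearFields

attribute [local instance 100] LieRing.ofAssociativeRing

variable {K g : Type*} [Field K] [LieRing g] [LieAlgebra K g] {ι : Type*} (b : Module.Basis ι K g)

/-- An element of `g` as a linear polynomial in the coordinates on the dual of `g`. -/
noncomputable def linearPoly : g →ₗ[K] MvPolynomial ι K := b.constr K MvPolynomial.X

/-- The linear vector field on the dual of `g` given by the coadjoint action. -/
noncomputable def linearField (x : g) : Derivation K (MvPolynomial ι K) (MvPolynomial ι K) :=
  MvPolynomial.mkDerivation K fun i => linearPoly b ⁅x, b i⁆

/-- This makes the construction independent of the basis, and it reduces the bracket relation in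
`linearFieldHom` to the Jacobi identity. -/
theorem linearField_linearPoly (x y : g) :
    linearField b x (linearPoly b y) = linearPoly b ⁅x, y⁆ := by
  have : (linearField b x).toLinearMap ∘ₗ linearPoly b =
      linearPoly b ∘ₗ (LieAlgebra.ad K g x) := by
    refine b.ext fun i => ?_
    simp [linearPoly, linearField, Module.Basis.constr_basis]
  exact LinearMap.congr_fun this y

/-- The Lie algebra `g` acts by linear vector fields on polynomials on its dual. -/
noncomputable def linearFieldHom : g →ₗ⁅K⁆ Module.End K (MvPolynomial ι K) where
  toFun x := (linearField b x).toLinearMap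
  map_add' x y := by
    have : linearField b (x + y) = linearField b x + linearField b y :=
      MvPolynomial.derivation_ext fun i => by simp [linearField]
    rw [this]; rfl
  map_smul' c x := by
    have : linearField b (c • x) = c • linearField b x :=
      MvPolynomial.derivation_ext fun i => by simp [linearField]
    rw [this]; rfl
  map_lie' := by
    intro x y
    have : linearField b ⁅x, y⁆ = ⁅linearField b x, linearField b y⁆ := by
      refine MvPolynomial.derivation_ext fun i => ?_
      have hX : (MvPolynomial.X i : MvPolynomial ι K) = linearPoly b (b i) := by
        simp [linearPoly, Module.Basis.constr_basis]
      rw [Derivation.commutator_apply, hX]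
      simp only [linearField_linearPoly]
      rw [← map_sub, lie_lie]
    rw [this]; rfl

end linearFields

/-! ### The enveloping algebra -/

section env

variable {g : Type*} [LieRing g] [LieAlgebra ℂ g]

theorem iota_lie (x y : g) : iota g x * iota g y - iota g y * iota g x = iota g ⁅x, y⁆ := by
  let _ : LieRing (Env g) := LieRing.ofAssociativeRing
  exact (LieHom.map_lie (UniversalEnvelopingAlgebra.ι ℂ (L := g)) x y).symm

theorem adEnv_iota (x : g) : adEnv g (iota g x) = LieAlgebra.ad ℂ g x :=
  UniversalEnvelopingAlgebra.lift_ι_apply ℂ (LieAlgebra.ad ℂ g) x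

theorem adjoin_range_iota : Algebra.adjoin ℂ (Set.range (iota g)) = ⊤ := by
  rw [eq_top_iff]
  rintro x -
  obtain ⟨t, rfl⟩ : ∃ t, UniversalEnvelopingAlgebra.mkAlgHom ℂ g t = x :=
    RingCon.mkₐ_surjective _ x
  induction t using TensorAlgebra.induction with
  | algebraMap r => rw [AlgHom.commutes]; exact Subalgebra.algebraMap_mem _ r
  | ι x => exact Algebra.subset_adjoin ⟨x, rfl⟩
  | mul a b ha hb => rw [map_mul]; exact Subalgebra.mul_mem _ ha hb
  | add a b ha hb => rw [map_add]; exact Subalgebra.add_mem _ ha hb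

/-- If the adjoint representation is faithful, products of nonzero elements of `g` do not vanish
in `U(g)`. -/
theorem list_prod_iota_ne_zero [FiniteDimensional ℂ g]
    (had : Function.Injective (LieAlgebra.ad ℂ g)) (l : List g) (hl : ∀ x ∈ l, x ≠ 0) :
    (l.map (iota g)).prod ≠ 0 := by
  classical
  -- Each kernel of `ad x` is a proper subspace by faithfulness, and finitely many proper subspaces
  -- do not cover g.
  have hy : ∃ y : g, ∀ x ∈ l, ⁅x, y⁆ ≠ 0 := by
    have := Subspace.biUnion_ne_univ_of_top_notMem (k := ℂ) (E := g)
      (s := (l.map fun x => LinearMap.ker (LieAlgebra.ad ℂ g x)).toFinset) (by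
        simp only [List.mem_toFinset, List.mem_map, not_exists, not_and]
        intro x hx h
        exact hl x hx (had (by rw [LinearMap.ker_eq_top.1 h, map_zero])))
    obtain ⟨y, hy⟩ := (Set.ne_univ_iff_exists_notMem _).1 this
    refine ⟨y, fun x hx h => hy ?_⟩
    simp only [Set.mem_iUnion]
    exact ⟨LinearMap.ker (LieAlgebra.ad ℂ g x), by simpa using ⟨x, hx, rfl⟩, by simpa using h⟩
  obtain ⟨y, hy⟩ := hy
  obtain ⟨p, hp⟩ := Module.exists_dual_forall_apply_ne_zero (K := ℂ)
    (fun x : {x // x ∈ l} => ⁅(x : g), y⁆) (fun x => hy x x.2)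
  let b := Module.finBasis ℂ g
  let ev : MvPolynomial _ ℂ →ₐ[ℂ] ℂ := MvPolynomial.aeval fun i => p (b i)
  have hev : ∀ x, ev (linearPoly b x) = p x := by
    have : ev.toLinearMap ∘ₗ linearPoly b = p :=
      b.ext fun i => by simp [ev, linearPoly]
    exact LinearMap.congr_fun this
  -- This f vanishes at the point p of the dual, while the field of x sends it to the linear
  -- function [x, y], whose value p([x, y]) at p is nonzero. So the product of the fields applied to
  -- a power of f is nonzero at p.
  let f := linearPoly b y - MvPolynomial.C (p y)
  have hf : ∀ x, linearField b x f = linearPoly b ⁅x, y⁆ := fun x => by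
    rw [map_sub, linearField_linearPoly, MvPolynomial.derivation_C, sub_zero]
  have hf0 : ev f = 0 := by
    rw [map_sub, hev, MvPolynomial.aeval_C, Algebra.algebraMap_self, RingHom.id_apply, sub_self]
  let F := UniversalEnvelopingAlgebra.lift ℂ (linearFieldHom b)
  have hF : ∀ x, F (iota g x) = ((linearField b x).toLinearMap : Module.End ℂ (MvPolynomial _ ℂ)) :=
    UniversalEnvelopingAlgebra.lift_ι_apply ℂ (linearFieldHom b)
  obtain ⟨c, r, hc, h⟩ := list_prod_derivation_apply_pow (l.map (linearField b)) f 0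
  intro h0
  have h1 : (l.map fun x => ((linearField b x).toLinearMap : Module.End ℂ (MvPolynomial _ ℂ))).prod = 0 := by
    have := congrArg F h0
    rw [map_zero, map_list_prod, List.map_map] at this
    rw [← this]
    congr 1
    exact List.map_congr_left fun x _ => (hF x).symm
  rw [List.map_map] at h
  simp only [Function.comp_def] at h
  rw [h1] at h
  have h2 := congrArg ev h
  simp only [LinearMap.zero_apply, map_zero, pow_zero, mul_one, map_add, map_mul, zero_add,
    pow_one, hf0, zero_mul, add_zero, map_natCast, List.map_map, Function.comp_def, hf,
    map_list_prod, hev] at h2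
  rcases mul_eq_zero.1 h2.symm with h3 | h3
  · exact hc (by exact_mod_cast h3)
  · obtain ⟨x, hx, h4⟩ := by simpa [List.prod_eq_zero_iff] using h3
    exact hp ⟨x, hx⟩ h4

end env


/-! ### Weights of the enveloping algebra -/

section envWeights

variable {g : Type*} [LieRing g] [LieAlgebra ℂ g] {H : LieSubalgebra ℂ g}

/-- The adjoint action of `h` on `U(g)`. -/
noncomputable def envAd (h : H) : Module.End ℂ (Env g) :=
  LinearMap.mulLeft ℂ (iota g h) - LinearMap.mulRight ℂ (iota g h)

theorem envWeightSpace_eq (lam : Module.Dual ℂ H) :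
    envWeightSpace lam = jointEigenspace envAd (lam : H → ℂ) := by
  ext X
  rw [mem_jointEigenspace]
  rfl

theorem one_mem_envWeightSpace : (1 : Env g) ∈ envWeightSpace (0 : Module.Dual ℂ H) := by
  intro h
  simp

theorem mul_mem_envWeightSpace {lam mu : Module.Dual ℂ H} {X Y : Env g}
    (hX : X ∈ envWeightSpace lam) (hY : Y ∈ envWeightSpace mu) :
    X * Y ∈ envWeightSpace (lam + mu) := by
  intro h
  have e : iota g h * (X * Y) - X * Y * iota g h =
      (iota g h * X - X * iota g h) * Y + X * (iota g h * Y - Y * iota g h) := by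
    noncomm_ring
  rw [e, hX h, hY h, LinearMap.add_apply, add_smul, smul_mul_assoc, mul_smul_comm]

theorem iota_mem_envWeightSpace {lam : Module.Dual ℂ H} {x : g}
    (hx : ∀ h : H, ⁅(h : g), x⁆ = lam h • x) : iota g x ∈ envWeightSpace lam := by
  intro h
  rw [iota_lie, hx, map_smul]

variable (H) in
-- Weights add under multiplication, so the span of the weight vectors is a subalgebra; it contains
-- the generators of U(g) as soon as g itself is spanned by weight vectors.
theorem iSup_envWeightSpace_eq_top
    (hg : ⨆ lam : rootLattice H, (envWeightSpace (lam : Module.Dual ℂ H)).comap (iota g) = ⊤) :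
    ⨆ lam : rootLattice H, envWeightSpace (lam : Module.Dual ℂ H) = ⊤ := by
  rw [eq_top_iff]
  rintro x -
  have hx : x ∈ Algebra.adjoin ℂ (Set.range (iota g)) := by rw [adjoin_range_iota]; trivial
  have hone : (1 : Env g) ∈ ⨆ lam : rootLattice H, envWeightSpace (lam : Module.Dual ℂ H) :=
    Submodule.mem_iSup_of_mem 0 one_mem_envWeightSpace
  induction hx using Algebra.adjoin_induction with
  | mem x hx =>
    obtain ⟨y, rfl⟩ := hx
    have hy : y ∈ (⊤ : Submodule ℂ g) := trivial
    rw [← hg] at hy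
    induction hy using Submodule.iSup_induction' with
    | mem i y hy => exact Submodule.mem_iSup_of_mem i hy
    | zero => rw [map_zero]; exact Submodule.zero_mem _
    | add x y _ _ h1 h2 => rw [map_add]; exact Submodule.add_mem _ h1 h2
  | algebraMap r => rw [Algebra.algebraMap_eq_smul_one]; exact Submodule.smul_mem _ r hone
  | add x y _ _ h1 h2 => exact Submodule.add_mem _ h1 h2
  | mul x y _ _ h1 h2 =>
    have key : ∀ x ∈ ⨆ lam : rootLattice H, envWeightSpace (lam : Module.Dual ℂ H),
        ∀ y ∈ ⨆ lam : rootLattice H, envWeightSpace (lam : Module.Dual ℂ H),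
        x * y ∈ ⨆ lam : rootLattice H, envWeightSpace (lam : Module.Dual ℂ H) := by
      intro x hx y hy
      induction hx using Submodule.iSup_induction' with
      | mem i x hx =>
        induction hy using Submodule.iSup_induction' with
        | mem j y hy => exact Submodule.mem_iSup_of_mem (i + j) (mul_mem_envWeightSpace hx hy)
        | zero => rw [mul_zero]; exact Submodule.zero_mem _
        | add y z _ _ h1 h2 => rw [mul_add]; exact Submodule.add_mem _ h1 h2
      | zero => rw [zero_mul]; exact Submodule.zero_mem _
      | add y z _ _ h1 h2 => rw [add_mul]; exact Submodule.add_mem _ h1 h2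
    exact key x h1 y h2

/-! ### Simple Lie algebras: root spaces and the root lattice. -/

section simple

variable [LieAlgebra.IsSimple ℂ g]

theorem ad_injective_of_isSimple : Function.Injective (LieAlgebra.ad ℂ g) :=
  let _ : LieRing (Module.End ℂ g) := LieRing.ofAssociativeRing
  (LieHom.ker_eq_bot _).1 (LieAlgebra.ad_ker_eq_bot_of_hasTrivialRadical ℂ g)

theorem iota_injective : Function.Injective (iota g) := fun x y h =>
  ad_injective_of_isSimple (by rw [← adEnv_iota, ← adEnv_iota, h])

variable [FiniteDimensional ℂ g] (H) [H.IsCartanSubalgebra]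

open LieAlgebra in
-- This is the root space decomposition of g. The Cartan subalgebra acts diagonalizably, so
-- generalized weight spaces are honest ones, and each weight is zero or a root.
theorem iSup_comap_envWeightSpace :
    ⨆ lam : rootLattice H, (envWeightSpace (lam : Module.Dual ℂ H)).comap (iota g) = ⊤ := by
  rw [eq_top_iff, ← LieSubmodule.top_toSubmodule (R := ℂ) (L := H),
    ← LieModule.iSup_genWeightSpace_eq_top' ℂ H g, LieSubmodule.iSup_toSubmodule]
  refine iSup_le fun χ => ?_
  have hχ : ∀ x ∈ rootSpace H χ, ∀ h : H, ⁅(h : g), x⁆ = LieModule.Weight.toLinear ℂ H g χ h • x :=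
    fun x hx h => IsKilling.lie_eq_smul_of_mem_rootSpace hx h
  have hmem : LieModule.Weight.toLinear ℂ H g χ ∈ rootLattice H := by
    by_cases h0 : LieModule.Weight.toLinear ℂ H g χ = 0
    · rw [h0]; exact Submodule.zero_mem _
    · obtain ⟨x, hx, hx0⟩ := χ.exists_ne_zero
      exact Submodule.subset_span ⟨h0, x, hx0, hχ x hx⟩
  refine le_iSup_of_le ⟨LieModule.Weight.toLinear ℂ H g χ, hmem⟩ fun x hx => ?_
  exact iota_mem_envWeightSpace (hχ x hx)

open LieAlgebra in
theorem neg_mem_roots {α : Module.Dual ℂ H} (hα : α ∈ roots H) : -α ∈ roots H := by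
  obtain ⟨h0, x, hx0, hx⟩ := hα
  have hmem : x ∈ rootSpace H α := by
    rw [rootSpace, LieModule.mem_genWeightSpace]
    refine fun h => ⟨1, ?_⟩
    rw [pow_one, LinearMap.sub_apply, sub_eq_zero]
    exact hx h
  -- As a bundled weight, `α` can be negated: the weights of a Killing Lie algebra are stable under
  -- sign.
  let χ : LieModule.Weight ℂ H g :=
    ⟨α, fun h => hx0 (by rw [rootSpace, h] at hmem; simpa using hmem)⟩
  obtain ⟨y, hy, hy0⟩ := (-χ).exists_ne_zero
  exact ⟨neg_ne_zero.2 h0, y, hy0, fun h => IsKilling.lie_eq_smul_of_mem_rootSpace hy h⟩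

/-- The list consists of root vectors, one for each term when `lam` is written as a sum of roots;
negative coefficients cost nothing because the negative of a root is a root. -/
theorem exists_list_of_mem_rootLattice {lam : Module.Dual ℂ H} (hlam : lam ∈ rootLattice H) :
    ∃ l : List g, (∀ x ∈ l, x ≠ 0) ∧ (l.map (iota g)).prod ∈ envWeightSpace lam := by
  -- A product of root vectors has no inverse to use in the negation step of the closure induction,
  -- so both signs are carried along.
  suffices h : ∀ lam ∈ rootLattice H, ∀ ε ∈ ({lam, -lam} : Set (Module.Dual ℂ H)),
      ∃ l : List g, (∀ x ∈ l, x ≠ 0) ∧ (l.map (iota g)).prod ∈ envWeightSpace ε from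
    h lam hlam lam (by simp)
  have hroot : ∀ α ∈ roots H,
      ∃ l : List g, (∀ x ∈ l, x ≠ 0) ∧ (l.map (iota g)).prod ∈ envWeightSpace α := by
    rintro α ⟨-, x, hx0, hx⟩
    exact ⟨[x], by simpa using hx0, by simpa using iota_mem_envWeightSpace hx⟩
  have hadd : ∀ lam mu : Module.Dual ℂ H,
      (∃ l : List g, (∀ x ∈ l, x ≠ 0) ∧ (l.map (iota g)).prod ∈ envWeightSpace lam) →
      (∃ l : List g, (∀ x ∈ l, x ≠ 0) ∧ (l.map (iota g)).prod ∈ envWeightSpace mu) →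
      ∃ l : List g, (∀ x ∈ l, x ≠ 0) ∧ (l.map (iota g)).prod ∈ envWeightSpace (lam + mu) := by
    rintro lam mu ⟨l, h1, h2⟩ ⟨l', h1', h2'⟩
    refine ⟨l ++ l', ?_, ?_⟩
    · intro x hx
      rcases List.mem_append.1 hx with hx | hx
      exacts [h1 x hx, h1' x hx]
    · rw [List.map_append, List.prod_append]
      exact mul_mem_envWeightSpace h2 h2'
  intro lam hlam
  rw [rootLattice, ← Submodule.mem_toAddSubgroup, Submodule.span_int_eq_addSubgroupClosure] at hlam
  induction hlam using AddSubgroup.closure_induction with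
  | mem α hα =>
    rintro ε (rfl | rfl)
    exacts [hroot _ hα, hroot _ (neg_mem_roots H hα)]
  | zero =>
    intro ε hε
    obtain rfl : ε = 0 := by simpa using hε
    exact ⟨[], by simp, by simpa using one_mem_envWeightSpace⟩
  | add x y _ _ h1 h2 =>
    rintro ε (rfl | rfl)
    · exact hadd _ _ (h1 _ (by simp)) (h2 _ (by simp))
    · rw [neg_add]
      exact hadd _ _ (h1 _ (by simp)) (h2 _ (by simp))
  | neg x _ h1 =>
    intro ε hε
    refine h1 ε ?_
    rwa [neg_neg, Set.pair_comm] at hε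

theorem envWeightSpace_ne_bot {lam : Module.Dual ℂ H} (hlam : lam ∈ rootLattice H) :
    envWeightSpace lam ≠ ⊥ := by
  obtain ⟨l, h1, h2⟩ := exists_list_of_mem_rootLattice H hlam
  intro h
  rw [h] at h2
  exact list_prod_iota_ne_zero ad_injective_of_isSimple l h1 (by simpa using h2)

theorem setOf_envWeightSpace_ne_bot :
    {lam : Module.Dual ℂ H | envWeightSpace lam ≠ ⊥} =
      (rootLattice H : Set (Module.Dual ℂ H)) := by
  ext lam
  refine ⟨fun h => ?_, envWeightSpace_ne_bot H⟩
  by_contra hlam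
  refine h ?_
  rw [envWeightSpace_eq]
  refine jointEigenspace_eq_bot_of_iSup_eq_top (W := fun mu : rootLattice H => envWeightSpace mu.1)
    (χ := fun mu : rootLattice H => mu.1) (fun i => (envWeightSpace_eq i.1).le)
    (iSup_envWeightSpace_eq_top H (iSup_comap_envWeightSpace H)) fun i hi => hlam ?_
  rw [← DFunLike.coe_injective hi]
  exact i.2

end simple

end envWeights

/-! ### The grading of `ℂ[φ^±]` -/

section laurent

theorem IsHom.mul {M N : ℤ} {φ ψ : Spinor} (hφ : IsHom M φ) (hψ : IsHom N ψ) :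
    IsHom (M + N) (φ * ψ) := by
  intro t ht z
  rw [Pi.mul_apply, Pi.mul_apply, hφ t ht z, hψ t ht z, zpow_add₀ ht.ne', smul_mul_smul_comm]

theorem isHom_one : IsHom 0 1 := by
  intro t ht z
  simp

/-- The points z and tz, t > 0, have the same radial projection to the sphere, so comparing each
with that projection compares them with each other. -/
theorem mem_laurentHom_iff {N : ℤ} {φ : laurent} : φ ∈ laurentHom N ↔ IsHom N φ := by
  constructor
  · intro h t ht z
    have hz : ‖(z : Plane)‖ ≠ 0 := norm_ne_zero_iff.2 z.2
    refine (h _ (smul_ne_zero ht.ne' z.2)).trans ?_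
    refine Eq.trans ?_ (congrArg (fun q : ℍ[ℝ] => (t ^ N : ℝ) • q) (h z.1 z.2)).symm
    refine Eq.trans ?_ (smul_smul _ _ _).symm
    congr 1
    · rw [norm_smul, Real.norm_of_nonneg ht.le, mul_zpow]
    · refine congrArg (φ : Spinor) (Subtype.ext ?_)
      change ‖t • (z : Plane)‖⁻¹ • t • (z : Plane) = ‖(z : Plane)‖⁻¹ • (z : Plane)
      rw [norm_smul, Real.norm_of_nonneg ht.le, smul_smul]
      congr 1
      field_simp
  · intro h z hz
    have hz' : ‖z‖ ≠ 0 := norm_ne_zero_iff.2 hz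
    refine Eq.trans ?_ (h ‖z‖ (norm_pos_iff.2 hz) ⟨_, _⟩)
    exact congrArg (φ : Spinor) (Subtype.ext (smul_inv_smul₀ hz' z).symm)

theorem d0_of_mem_laurentHom {N : ℤ} {φ : laurent} (h : φ ∈ laurentHom N) :
    d0 φ = ((N : ℝ) / 2) • φ :=
  Subtype.ext (euler_of_hom (laurent_smooth φ.2) (mem_laurentHom_iff.1 h))

theorem one_mem_laurentHom : (1 : laurent) ∈ laurentHom 0 :=
  mem_laurentHom_iff.2 isHom_one

theorem mul_mem_laurentHom {M N : ℤ} {φ ψ : laurent} (hφ : φ ∈ laurentHom M)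
    (hψ : ψ ∈ laurentHom N) : φ * ψ ∈ laurentHom (M + N) :=
  mem_laurentHom_iff.2 ((mem_laurentHom_iff.1 hφ).mul (mem_laurentHom_iff.1 hψ))

/-- The sum of the homogeneous pieces is closed under products, since degrees add, and contains the
homogeneous generators. -/
theorem iSup_laurentHom_eq_top : ⨆ N, laurentHom N = ⊤ := by
  rw [eq_top_iff]
  rintro ⟨φ, hφ⟩ -
  induction hφ using Algebra.adjoin_induction with
  | mem φ h =>
    obtain ⟨N, hN⟩ := generators_hom h
    exact Submodule.mem_iSup_of_mem N (mem_laurentHom_iff.2 hN)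
  | algebraMap r =>
    exact Submodule.mem_iSup_of_mem 0 ((laurentHom 0).smul_mem r one_mem_laurentHom |> fun h => by
      rwa [← Algebra.algebraMap_eq_smul_one] at h)
  | add φ ψ _ _ h1 h2 => exact Submodule.add_mem _ h1 h2
  | mul φ ψ hφ hψ h1 h2 =>
    have key : ∀ x ∈ ⨆ N, laurentHom N, ∀ y ∈ ⨆ N, laurentHom N, x * y ∈ ⨆ N, laurentHom N := by
      intro x hx y hy
      induction hx using Submodule.iSup_induction' with
      | mem i x hx =>
        induction hy using Submodule.iSup_induction' with
        | mem j y hy => exact Submodule.mem_iSup_of_mem (i + j) (mul_mem_laurentHom hx hy)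
        | zero => rw [mul_zero]; exact Submodule.zero_mem _
        | add y z _ _ h1 h2 => rw [mul_add]; exact Submodule.add_mem _ h1 h2
      | zero => rw [zero_mul]; exact Submodule.zero_mem _
      | add y z _ _ h1 h2 => rw [add_mul]; exact Submodule.add_mem _ h1 h2
    exact key _ h1 _ h2

theorem cscale_one (φ : Spinor) : cscale 1 φ = φ := by
  funext z; simp [cscale, column_fst_snd]

/-- `φ^{+(1,0,0)}` as an element of `ℂ[φ^±]`. -/
noncomputable def phiPlus100 : laurent :=
  ⟨phiPlus 1 0 0, Algebra.subset_adjoin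
    ⟨1, 1, 0, 0, zero_le_one, by norm_num, Or.inl (cscale_one _).symm⟩⟩

/-- `φ^{-(0,0,0)}` as an element of `ℂ[φ^±]`. -/
noncomputable def phiMinus000 : laurent :=
  ⟨phiMinus 0 0 0, Algebra.subset_adjoin
    ⟨1, 0, 0, 0, le_rfl, by norm_num, Or.inr (cscale_one _).symm⟩⟩

theorem pow_mem_laurentHom {N : ℤ} {φ : laurent} (h : φ ∈ laurentHom N) (n : ℕ) :
    φ ^ n ∈ laurentHom (n * N) := by
  induction n with
  | zero => simpa using one_mem_laurentHom
  | succ n ih =>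
    rw [pow_succ]
    convert mul_mem_laurentHom ih h using 2
    push_cast; ring

theorem exists_mem_laurentHom_ne_zero (N : ℤ) : ∃ φ ∈ laurentHom N, φ ≠ 0 := by
  -- The degrees are 1 for φ^{+(1,0,0)} and -3 for φ^{-(0,0,0)}. With b = |N| the exponent a = N +
  -- 3|N| is nonnegative.
  obtain ⟨a, b, hab⟩ : ∃ a b : ℕ, (a : ℤ) * 1 + b * (-((0 : ℕ) + 3 : ℤ)) = N :=
    ⟨(N + 3 * N.natAbs).toNat, N.natAbs, by omega⟩
  refine ⟨phiPlus100 ^ a * phiMinus000 ^ b, ?_, ?_⟩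
  · rw [← hab]
    exact mul_mem_laurentHom
      (pow_mem_laurentHom (mem_laurentHom_iff.2 (by exact_mod_cast phiPlus_hom 0 zero_le_one)) a)
      (pow_mem_laurentHom (mem_laurentHom_iff.2 (phiMinus_hom 0 le_rfl)) b)
  · intro h
    -- At the point (0, 1) both spinors are nonzero, each having an entry proportional to z₂ there;
    -- powers and products of nonzero quaternions are nonzero.
    let e : Plane := EuclideanSpace.single 1 1
    have he : e ≠ 0 := fun h => by simpa [e] using congrArg (fun z : Plane => z 1) h
    have h1 := congrArg (fun φ : laurent => (φ : Spinor) ⟨e, he⟩) h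
    simp only [Subalgebra.coe_mul, Subalgebra.coe_pow, Pi.mul_apply, Pi.pow_apply,
      Subalgebra.coe_zero, Pi.zero_apply] at h1
    have hp : phiPlus 1 0 0 ⟨e, he⟩ ≠ 0 := fun h => by
      have := congrArg (fun q : ℍ[ℝ] => q.imJ) h
      simp [phiPlus, normFactor, vPoly, polyEval, pz, e, Nat.factorial] at this
    have hm : phiMinus 0 0 0 ⟨e, he⟩ ≠ 0 := fun h => by
      have := congrArg (fun q : ℍ[ℝ] => q.re) h
      simp [phiMinus, normFactor, wPoly, polyEval, pz, pzbar, e] at this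
    rcases mul_eq_zero.1 h1 with h2 | h2
    · exact pow_ne_zero _ hp h2
    · exact pow_ne_zero _ hm h2

theorem phi001_eq_one : phi001 = 1 := by
  refine Subtype.ext (funext fun z => ?_)
  ext <;> simp [phi001, phiPlus, normFactor, vPoly, polyEval, eMinus]

theorem d0_one : d0 1 = 0 := by
  rw [d0_of_mem_laurentHom one_mem_laurentHom]
  simp

/-- `Theta` differentiates its argument, and a constant has zero derivative. Hence ĥ acts on ĝ
without central terms. -/
theorem cocycle_one_left (ψ : laurent) : cocycle 1 ψ = 0 := by
  have h1 : IsSmooth (1 : Spinor) := isSmooth_const 1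
  have h : Theta 1 = 0 := by
    funext z
    rw [Theta_eq h1]
    have : ext0 (1 : Spinor) =ᶠ[nhds (z : Plane)] fun _ => 1 := by
      filter_upwards [eventually_ne z] with w hw
      rw [ext0_apply _ hw, Pi.one_apply]
    rw [this.fderiv_eq]
    simp
  change cocycleFun 1 ψ = 0
  simp [cocycleFun, h, quatTr]

end laurent


/-! ### Weights of `ĝ` -/

section ghatWeights

theorem tmul_ne_zero_of_ne_zero {K V W : Type*} [Field K] [Infinite K] [AddCommGroup V] [Module K V]
    [AddCommGroup W] [Module K W] {v : V} {w : W} (hv : v ≠ 0) (hw : w ≠ 0) :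
    v ⊗ₜ[K] w ≠ 0 := by
  obtain ⟨f, hf⟩ := Module.exists_dual_forall_apply_ne_zero (K := K) (fun _ : Unit => v)
    fun _ => hv
  intro h
  -- Contracting the first factor with a functional that does not vanish on `v` returns a nonzero
  -- multiple of `w`.
  have h1 := congrArg ((TensorProduct.lid K W).toLinearMap ∘ₗ TensorProduct.map f LinearMap.id) h
  simp only [LinearMap.comp_apply, LinearEquiv.coe_coe, TensorProduct.map_tmul, map_zero,
    LinearMap.id_apply, TensorProduct.lid_tmul] at h1
  exact (smul_ne_zero (hf ()) hw) h1

variable {g : Type*} [LieRing g] [LieAlgebra ℂ g] {H : LieSubalgebra ℂ g}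

theorem laurent_one_ne_zero : (1 : laurent) ≠ 0 := fun h => by
  obtain ⟨φ, -, h0⟩ := exists_mem_laurentHom_ne_zero 0
  exact h0 (by rw [← one_mul φ, h, zero_mul])

theorem currentCocycle_tmul_one (X : Env g) (η : Current g) :
    currentCocycle g (X ⊗ₜ 1) η = 0 := by
  induction η using TensorProduct.induction_on with
  | zero => exact map_zero _
  | tmul Y ψ => rw [currentCocycle_tmul, cocycle_one_left, Complex.ofReal_zero, mul_zero]
  | add x y hx hy => rw [map_add, hx, hy, add_zero]

theorem hhatIncl_apply (k : Hhat H) : hhatIncl H k = (iota g k.1 ⊗ₜ 1, k.2) := by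
  rw [← phi001_eq_one]
  rfl

/-- The a and d coordinates of ξ do not contribute: a is central, and bracketing h ⊗ 1 with d gives
-`d0 1` ⊗ h = 0. -/
theorem ghatBracket_hhatIncl (k : Hhat H) (ξ : Ghat g) :
    ghatBracket g (hhatIncl H k) ξ =
      (currentBracket g (iota g k.1 ⊗ₜ 1) ξ.1 + k.2.2 • dCurrent g ξ.1, 0, 0) := by
  rw [hhatIncl_apply]
  simp only [ghatBracket, LinearMap.mk₂_apply, currentCocycle_tmul_one, dCurrent_tmul, d0_one,
    TensorProduct.tmul_zero, smul_zero, sub_zero]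

theorem homTensor_induction {m : ℤ} {V : Submodule ℂ (Env g)} {P : Current g → Prop}
    (tmul : ∀ X ∈ V, ∀ φ ∈ laurentHom m, P (X ⊗ₜ φ)) (zero : P 0)
    (add : ∀ x y, P x → P y → P (x + y)) {ξ : Current g} (hξ : ξ ∈ homTensor m V) : P ξ := by
  obtain ⟨t, rfl⟩ := hξ
  induction t using TensorProduct.induction_on with
  | zero => rwa [map_zero]
  | tmul X φ => exact tmul X X.2 φ φ.2
  | add x y hx hy => rw [map_add]; exact add _ _ hx hy

theorem tmul_mem_homTensor {m : ℤ} {V : Submodule ℂ (Env g)} {X : Env g} (hX : X ∈ V)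
    {φ : laurent} (hφ : φ ∈ laurentHom m) : X ⊗ₜ φ ∈ homTensor m V :=
  ⟨(⟨X, hX⟩ : V) ⊗ₜ (⟨φ, hφ⟩ : laurentHom m), rfl⟩

theorem dCurrent_of_mem_homTensor {m : ℤ} {V : Submodule ℂ (Env g)} {ξ : Current g}
    (hξ : ξ ∈ homTensor m V) : dCurrent g ξ = ((m : ℂ) / 2) • ξ := by
  refine homTensor_induction (P := fun ξ => dCurrent g ξ = ((m : ℂ) / 2) • ξ) ?_ ?_ ?_ hξ
  · intro X _ φ hφ
    -- The factor m/2 is real, so it can cross the tensor product over ℝ and act as a complex scalar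
    -- on U(g).
    rw [dCurrent_tmul, d0_of_mem_laurentHom hφ, ← TensorProduct.smul_tmul, ← Complex.coe_smul,
      TensorProduct.smul_tmul']
    push_cast
    rfl
  · simp
  · intro x y hx hy
    rw [map_add, hx, hy, smul_add]

theorem currentBracket_of_mem_homTensor {m : ℤ} {lam : Module.Dual ℂ H} {ξ : Current g}
    (hξ : ξ ∈ homTensor m (envWeightSpace lam)) (h : H) :
    currentBracket g (iota g h ⊗ₜ 1) ξ = lam h • ξ := by
  refine homTensor_induction
    (P := fun ξ => currentBracket g (iota g h ⊗ₜ 1) ξ = lam h • ξ) ?_ ?_ ?_ hξ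
  -- As 1 commutes with φ, the commutator takes place in U(g) alone.
  · intro X hX φ _
    rw [currentBracket_tmul, one_mul, mul_one, ← TensorProduct.sub_tmul, hX h,
      TensorProduct.smul_tmul']
  · simp
  · intro x y hx hy
    rw [map_add, hx, hy, smul_add]

theorem iSup_homTensor_eq_top {ι : Type*} {V : ι → Submodule ℂ (Env g)} (hV : ⨆ i, V i = ⊤) :
    ⨆ p : ℤ × ι, homTensor p.1 (V p.2) = ⊤ := by
  rw [eq_top_iff]
  rintro ξ -
  induction ξ using TensorProduct.induction_on with
  | zero => exact Submodule.zero_mem _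
  | tmul X φ =>
    have hX : X ∈ ⨆ i, V i := by rw [hV]; trivial
    have hφ : φ ∈ ⨆ N, laurentHom N := by rw [iSup_laurentHom_eq_top]; trivial
    induction hX using Submodule.iSup_induction' with
    | mem i X hX =>
      induction hφ using Submodule.iSup_induction' with
      | mem m φ hφ =>
        exact Submodule.mem_iSup_of_mem (m, i) (tmul_mem_homTensor hX hφ)
      | zero => rw [TensorProduct.tmul_zero]; exact Submodule.zero_mem _
      | add x y _ _ h1 h2 => rw [TensorProduct.tmul_add]; exact Submodule.add_mem _ h1 h2
    | zero => rw [TensorProduct.zero_tmul]; exact Submodule.zero_mem _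
    | add x y _ _ h1 h2 => rw [TensorProduct.add_tmul]; exact Submodule.add_mem _ h1 h2
  | add x y hx hy => exact Submodule.add_mem _ hx hy

theorem homTensor_ne_bot (m : ℤ) {V : Submodule ℂ (Env g)} (hV : V ≠ ⊥) : homTensor m V ≠ ⊥ := by
  obtain ⟨X, hX, hX0⟩ := V.ne_bot_iff.1 hV
  obtain ⟨φ, hφ, hφ0⟩ := exists_mem_laurentHom_ne_zero m
  exact (Submodule.ne_bot_iff _).2
    ⟨X ⊗ₜ φ, tmul_mem_homTensor hX hφ, tmul_ne_zero_of_ne_zero hX0 hφ0⟩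

/-- The weight `(m/2) δ + λ` of `ĥ`. -/
noncomputable def ghatWeight (p : ℤ × rootLattice H) : Module.Dual ℂ (Hhat H) :=
  ((p.1 : ℂ) / 2) • delta H + extendDual (p.2 : Module.Dual ℂ H)

theorem ghatWeight_apply (p : ℤ × rootLattice H) (k : Hhat H) :
    ghatWeight p k = ((p.1 : ℂ) / 2) * k.2.2 + p.2.1 k.1 := rfl

/-- Evaluation at d recovers m, and restriction to h recovers λ. -/
theorem ghatWeight_injective : Function.Injective (ghatWeight (H := H)) := by
  rintro ⟨m, lam⟩ ⟨n, mu⟩ h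
  have h1 := LinearMap.congr_fun h (0, 0, 1)
  simp only [ghatWeight_apply, map_zero, mul_one, add_zero] at h1
  refine Prod.ext ?_ (Subtype.ext (LinearMap.ext fun x => ?_))
  · have : (m : ℂ) = n := by linear_combination 2 * h1
    exact_mod_cast this
  · have h2 := LinearMap.congr_fun h (x, 0, 0)
    simpa only [ghatWeight_apply, mul_zero, zero_add] using h2

theorem ghatWeightSpace_eq (mu : Module.Dual ℂ (Hhat H)) :
    ghatWeightSpace mu =
      jointEigenspace (fun k => ghatBracket g (hhatIncl H k)) (mu : Hhat H → ℂ) := by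
  ext ξ
  rw [mem_jointEigenspace]
  rfl

open Classical in
/-- The explicit form of the weight space of weight `(m/2) δ + λ`. -/
noncomputable def weightPart (p : ℤ × rootLattice H) : Submodule ℂ (Ghat g) :=
  (homTensor p.1 (envWeightSpace (p.2 : Module.Dual ℂ H))).prod (if p = 0 then ⊤ else ⊥)

theorem weightPart_le (p : ℤ × rootLattice H) :
    weightPart p ≤ jointEigenspace (fun k => ghatBracket g (hhatIncl H k))
      (ghatWeight p : Hhat H → ℂ) := by
  rintro ⟨ξ, s⟩ ⟨h1, h2⟩
  rw [mem_jointEigenspace]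
  intro k
  -- The bracket has zero a and d coordinates, so the weight must annihilate `s`: either the weight
  -- is zero or `s` is.
  have hs : ghatWeight p k • s = 0 := by
    by_cases hp : p = 0
    · subst hp
      simp [ghatWeight_apply]
    · rw [if_neg hp, SetLike.mem_coe, Submodule.mem_bot] at h2
      rw [show s = 0 from h2, smul_zero]
  rw [ghatBracket_hhatIncl, Prod.smul_mk, hs]
  refine Prod.ext ?_ rfl
  change currentBracket g (iota g k.1 ⊗ₜ 1) ξ + k.2.2 • dCurrent g ξ = _
  rw [currentBracket_of_mem_homTensor h1, dCurrent_of_mem_homTensor h1, ghatWeight_apply]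
  module

variable [LieAlgebra.IsSimple ℂ g] (H)

theorem hhatIncl_injective : Function.Injective (hhatIncl H) := by
  rw [← LinearMap.ker_eq_bot, LinearMap.ker_eq_bot']
  intro k hk
  rw [hhatIncl_apply] at hk
  refine Prod.ext ?_ (congrArg (fun ξ : Ghat g => ξ.2) hk)
  by_contra h0
  refine tmul_ne_zero_of_ne_zero (K := ℝ) ?_ laurent_one_ne_zero
    (congrArg (fun ξ : Ghat g => ξ.1) hk)
  intro h
  exact h0 (Subtype.ext (iota_injective (h.trans (map_zero _).symm)))

variable [FiniteDimensional ℂ g] [H.IsCartanSubalgebra]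

theorem iSup_weightPart_eq_top : ⨆ p : ℤ × rootLattice H, weightPart p = (⊤ : Submodule ℂ _) := by
  have h := iSup_homTensor_eq_top (iSup_envWeightSpace_eq_top H (iSup_comap_envWeightSpace H))
  rw [eq_top_iff]
  rintro ⟨ξ, s⟩ -
  have h1 : ((ξ, 0) : Ghat g) ∈ ⨆ p : ℤ × rootLattice H, weightPart p := by
    have hξ : ξ ∈ (⊤ : Submodule ℂ (Current g)) := trivial
    rw [← h] at hξ
    have : (⨆ p : ℤ × rootLattice H, homTensor p.1 (envWeightSpace p.2.1)) ≤
        (⨆ p : ℤ × rootLattice H, weightPart p).comap (LinearMap.inl ℂ (Current g) (ℂ × ℂ)) :=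
      iSup_le fun p x hx => Submodule.mem_iSup_of_mem p ⟨hx, Submodule.zero_mem _⟩
    exact this hξ
  have h2 : ((0, s) : Ghat g) ∈ ⨆ p : ℤ × rootLattice H, weightPart p :=
    Submodule.mem_iSup_of_mem 0 ⟨Submodule.zero_mem _, by rw [if_pos rfl]; trivial⟩
  simpa using Submodule.add_mem _ h1 h2

theorem ghatWeightSpace_ghatWeight (p : ℤ × rootLattice H) :
    ghatWeightSpace (ghatWeight p) = weightPart p := by
  rw [ghatWeightSpace_eq]
  exact jointEigenspace_eq_of_iSup_eq_top (χ := fun p => ghatWeight (H := H) p)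
    (DFunLike.coe_injective.comp ghatWeight_injective) weightPart_le (iSup_weightPart_eq_top H) p

theorem weightPart_ne_bot (p : ℤ × rootLattice H) : weightPart p ≠ ⊥ := by
  obtain ⟨ξ, hξ, h0⟩ := (Submodule.ne_bot_iff _).1
    (homTensor_ne_bot p.1 (envWeightSpace_ne_bot H p.2.2))
  exact (Submodule.ne_bot_iff _).2 ⟨(ξ, 0), ⟨hξ, Submodule.zero_mem _⟩,
    fun h => h0 (congrArg Prod.fst h)⟩

theorem ghatWeightSpace_ne_bot_iff (mu : Module.Dual ℂ (Hhat H)) :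
    ghatWeightSpace mu ≠ ⊥ ↔ ∃ p, ghatWeight p = mu := by
  constructor
  · intro h
    by_contra! hmu
    refine h ?_
    rw [ghatWeightSpace_eq]
    exact jointEigenspace_eq_bot_of_iSup_eq_top (χ := fun p => ghatWeight (H := H) p)
      weightPart_le (iSup_weightPart_eq_top H) fun p hp => hmu p (DFunLike.coe_injective hp)
  · rintro ⟨p, rfl⟩
    rw [ghatWeightSpace_ghatWeight]
    exact weightPart_ne_bot H p

/-- The Cartan subalgebra is abelian, so its elements have weight zero in U(g), and the constant 1
has degree zero. -/
theorem range_hhatIncl_le :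
    LinearMap.range (hhatIncl H) ≤ weightPart (0 : ℤ × rootLattice H) := by
  rintro _ ⟨k, rfl⟩
  rw [hhatIncl_apply]
  refine ⟨tmul_mem_homTensor (iota_mem_envWeightSpace fun h => ?_) one_mem_laurentHom, by
    rw [if_pos rfl]; trivial⟩
  rw [← LieSubalgebra.coe_bracket, trivial_lie_zero]
  simp

end ghatWeights

end QuatCurrent

open QuatCurrent
theorem mainTheorem3 {g : Type*} [LieRing g] [LieAlgebra ℂ g] [FiniteDimensional ℂ g]
    [LieAlgebra.IsSimple ℂ g] (H : LieSubalgebra ℂ g) [H.IsCartanSubalgebra] :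
    -- `ĥ` is a subspace of `ĝ`, and `Σ` is the set of weights of `U(g)`
    Function.Injective (hhatIncl H) ∧
    {lam : Module.Dual ℂ H | envWeightSpace lam ≠ ⊥} = (rootLattice H : Set (Module.Dual ℂ H)) ∧
    -- the set of weights of `ĝ`
    {mu : Module.Dual ℂ (Hhat H) | ghatWeightSpace mu ≠ ⊥} =
      {mu | ∃ m : ℤ, ∃ lam ∈ rootLattice H,
        mu = ((m : ℂ) / 2) • delta H + extendDual lam} ∪
      {mu | ∃ m : ℤ, mu = ((m : ℂ) / 2) • delta H} ∧
    -- the weight spaces for `λ ≠ 0`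
    (∀ m : ℤ, ∀ lam ∈ rootLattice H, lam ≠ 0 →
      ghatWeightSpace (((m : ℂ) / 2) • delta H + extendDual lam) =
        (homTensor m (envWeightSpace lam)).prod ⊥) ∧
    -- the weight spaces for `λ = 0`
    ghatWeightSpace ((0 : ℂ) • delta H) =
      (homTensor 0 (envWeightSpace (0 : Module.Dual ℂ H))).prod ⊤ ∧
    LinearMap.range (hhatIncl H) ≤ ghatWeightSpace ((0 : ℂ) • delta H) ∧
    (∀ m : ℤ, m ≠ 0 →
      ghatWeightSpace (((m : ℂ) / 2) • delta H) =
        (homTensor m (envWeightSpace (0 : Module.Dual ℂ H))).prod ⊥) ∧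
    -- the weight space decomposition
    (open Classical in DirectSum.IsInternal (fun p : ℤ × rootLattice H =>
      ghatWeightSpace (((p.1 : ℂ) / 2) • delta H + extendDual (p.2 : Module.Dual ℂ H)))) := by
  have hzero : ∀ m : ℤ, ((m : ℂ) / 2) • delta H = ghatWeight (m, 0) := fun m =>
    LinearMap.ext fun k => by simp [ghatWeight, extendDual]
  have hzero' : (0 : ℂ) • delta H = ghatWeight (0 : ℤ × rootLattice H) := by
    refine Eq.trans ?_ (hzero 0); simp
  have hzeroSpace : ghatWeightSpace ((0 : ℂ) • delta H) =
      weightPart (0 : ℤ × rootLattice H) := by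
    rw [hzero', ghatWeightSpace_ghatWeight]
  refine ⟨hhatIncl_injective H, setOf_envWeightSpace_ne_bot H, ?_, ?_, ?_, ?_, ?_, ?_⟩
  · ext mu
    rw [Set.mem_ofPred_eq, ghatWeightSpace_ne_bot_iff]
    constructor
    · rintro ⟨⟨m, lam, hlam⟩, rfl⟩
      exact Or.inl ⟨m, lam, hlam, rfl⟩
    · rintro (⟨m, lam, hlam, rfl⟩ | ⟨m, rfl⟩)
      · exact ⟨(m, ⟨lam, hlam⟩), rfl⟩
      -- The second set of the union is the case λ = 0 of the first.
      · exact ⟨(m, 0), (hzero m).symm⟩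
  · intro m lam hlam h0
    refine (ghatWeightSpace_ghatWeight H (m, ⟨lam, hlam⟩)).trans ?_
    rw [weightPart, if_neg]
    exact fun h => h0 (congrArg (fun p : ℤ × rootLattice H => (p.2 : Module.Dual ℂ H)) h)
  · rw [hzeroSpace, weightPart, if_pos rfl]
    rfl
  · rw [hzeroSpace]
    exact range_hhatIncl_le H
  · intro m hm
    rw [hzero, ghatWeightSpace_ghatWeight, weightPart, if_neg]
    · rfl
    · exact fun h => hm (congrArg Prod.fst h)
  · classical
    rw [DirectSum.isInternal_submodule_iff_iSupIndep_and_iSup_eq_top]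
    constructor
    · have h := iSupIndep_jointEigenspace (fun k => ghatBracket g (hhatIncl H k))
        (χ := fun p => ghatWeight (H := H) p) (DFunLike.coe_injective.comp ghatWeight_injective)
      simp only [← ghatWeightSpace_eq] at h
      exact h
    · rw [← iSup_weightPart_eq_top H]
      exact iSup_congr fun p => ghatWeightSpace_ghatWeight H p
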